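/- Consider finite-horizon Markov decision processes $\mathcal M=(T,\mathcal S,\mathcal A,\mathcal R,p,g)$, where $T\ge 1$ is an integer horizon; $\mathcal S$ is a finite set of states with a designated initial state; $\mathcal A$ assigns to each state a finite nonempty set of available actions; $\mathcal R\subset\mathbb Q$ is a finite set of possible immediate rewards; and, for $0\le t<T$, $p_t(\cdot\mid s,a)$ and $g_t(\cdot\mid s,a)$ are rational-valued probability distributions on $\mathcal S$ and $\mathcal R$. Starting from the initial state, at each time $t=0,\dots,T-1$ an action $A_t$ available at the current state $S_t$ is chosen; then, independently given $(S_t,A_t)$, a reward $R_t$ is drawn from $g_t(\cdot\mid S_t,A_t)$ and the next state $S_{t+1}$ from $p_t(\cdot\mid S_t,A_t)$. Let $W_t=\sum_{k<t}R_k$, let $H_t=(S_{0:t},A_{0:t-1},R_{0:t-1})$ be the history, and let $U_0,\dots,U_{T-1}$ be i.i.d. uniform on $[0,1]$, independent of everything else. Let $\Pi_{h,u}$ be the set of randomized history-based policies, $A_t=\mu_t(H_t,U_{0:t})$ with $\mu_t$ measurable in $U_{0:t}$, and let $\Pi_{t,s,w}\subset\Pi_{h,u}$ be the set of deterministic policies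 of the form $A_t=\mu_t(S_t,W_t)$. For a policy $\pi$ let $V_\pi=\mathrm{Var}_\pi(W_T)$. (a) For every such $\mathcal M$: if there exists some $\pi\in\Pi_{h,u}$ with $V_\pi=0$, then there exists some $\pi'\in\Pi_{t,s,w}$ with $V_{\pi'}=0$. (b) Suppose that the immediate rewards are integers, and let $K=\max_{r\in\mathcal R}|r|$. Then the problem of determining, for a given $\mathcal M$, whether there exists a policy $\pi\in\Pi_{h,u}$ with $V_\pi=0$ admits a pseudopolynomial time algorithm, that is, a single algorithm that decides it in time polynomial in $K$ and the size of the instance. (An instance lists all data of $\mathcal M$, with integers and rationals in binary; time is the logarithmic cost on a random access machine, which is polynomially equivalent to the running time of a Turing machine.) -/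

import Mathlib

open MeasureTheory ProbabilityTheory
open scoped unitInterval ENNReal

noncomputable section

namespace MeanVariance

/-! ### Finite-horizon Markov decision processes -/

/-- A finite-horizon MDP with state set `S` and, for each state `s`, the set `A s` of available
actions. All probabilities and rewards are rational. -/
structure MDP (S : Type*) [Fintype S] (A : S → Type*) where
  /-- the time horizon -/
  T : ℕ
  T_pos : 0 < T
  /-- the designated initial state -/
  init : S
  finite_actions : ∀ s, Finite (A s)
  nonempty_actions : ∀ s, Nonempty (A s)
  /-- the finite set of possible immediate rewards -/
  R : Finset ℚ
  /-- `p t s a s'` is the probability that the state at time `t + 1` is `s'`, given that the state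
  and action at time `t` are `s` and `a` -/
  p : Fin T → (s : S) → A s → S → ℚ
  p_nonneg : ∀ t s a s', 0 ≤ p t s a s'
  p_sum : ∀ t s a, ∑ s', p t s a s' = 1
  /-- `g t s a r` is the probability that the reward at time `t` is `r`, given that the state and
  action at time `t` are `s` and `a` -/
  g : Fin T → (s : S) → A s → R → ℚ
  g_nonneg : ∀ t s a r, 0 ≤ g t s a r
  g_sum : ∀ t s a, ∑ r, g t s a r = 1

/-- A finite family of nonnegative rationals with sum `1`, as a probability mass function. -/
def ratPMF {α : Type*} [Fintype α] (f : α → ℚ) (h0 : ∀ a, 0 ≤ f a) (h1 : ∑ a, f a = 1) : PMF α :=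
  PMF.ofFintype (fun a => ENNReal.ofReal (f a : ℝ)) (by
    rw [← ENNReal.ofReal_sum_of_nonneg (fun a _ => by exact_mod_cast h0 a), ← Rat.cast_sum, h1]
    simp)

namespace MDP

variable {S : Type*} [Fintype S] {A : S → Type*} (M : MDP S A)

/-- What happens at one time step: the state, the action taken there, and the reward obtained. -/
abbrev Step : Type _ := (Σ s, A s) × M.R

/-- The history `(S_{0:t}, A_{0:t-1}, R_{0:t-1})`: the first `t` steps, and the state at time `t`.
For `t = T` this is a complete trajectory. -/
structure History (t : ℕ) where
  steps : Fin t → M.Step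
  state : S

instance (t : ℕ) : MeasurableSpace (M.History t) := ⊤

variable {M} in
/-- The cumulative reward `W_t = R_0 + ⋯ + R_{t-1}` along a history. -/
def History.W {t : ℕ} (h : M.History t) : ℚ := ∑ i, ((h.steps i).2 : ℚ)

/-- A randomized history-based policy: the action at time `t` is a measurable function of the
history and of the first `t + 1` randomization variables, with values in the actions available
at the current state. -/
structure Policy where
  act : (t : Fin M.T) → (h : M.History t) → (Fin (t + 1) → I) → A h.state
  measurable_act : ∀ t h a, MeasurableSet {u | act t h u = a}

/-- The deterministic policies whose action at time `t` depends only on `t`, the current state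
and the current cumulative reward. -/
def PiTSW : Set M.Policy :=
  {π | ∃ μ : Fin M.T → (s : S) → ℚ → A s, ∀ t h u, π.act t h u = μ t h.state h.W}

variable {M} in
/-- The history obtained by appending an action, a reward and a next state. -/
def History.extend {t : ℕ} (h : M.History t) (a : A h.state) (r : M.R) (s' : S) : M.History (t + 1) :=
  ⟨Fin.snoc (α := fun _ => M.Step) h.steps (⟨h.state, a⟩, r), s'⟩

/-- The law of the history at time `t`, when the policy `π` is followed and the randomization
variables take the values `u`. -/
def law (π : M.Policy) (u : Fin M.T → I) : (t : ℕ) → t ≤ M.T → PMF (M.History t)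
  | 0, _ => PMF.pure ⟨Fin.elim0, M.init⟩
  | t + 1, ht =>
    (law π u t (Nat.le_of_succ_le ht)).bind fun h =>
      let a := π.act ⟨t, ht⟩ h (fun i => u (Fin.castLE ht i))
      (ratPMF (M.g ⟨t, ht⟩ h.state a) (M.g_nonneg _ _ _) (M.g_sum _ _ _)).bind fun r =>
        (ratPMF (M.p ⟨t, ht⟩ h.state a) (M.p_nonneg _ _ _) (M.p_sum _ _ _)).map fun s' =>
          h.extend a r s'

/-- The probability of a complete trajectory under `π`; the randomization variables are
i.i.d. uniform on `[0, 1]`. -/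
def trajProb (π : M.Policy) (τ : M.History M.T) : ℝ≥0∞ :=
  ∫⁻ u : Fin M.T → I, M.law π u M.T le_rfl τ

/-- The law of the trajectory under `π`. -/
def trajLaw (π : M.Policy) : Measure (M.History M.T) :=
  Measure.sum fun τ => M.trajProb π τ • Measure.dirac τ

/-- The variance of the total reward `W_T` under `π`. -/
def V (π : M.Policy) : ℝ := Var[fun τ : M.History M.T => (τ.W : ℝ); M.trajLaw π]

end MDP

/-! ### A random access machine with logarithmic cost -/

/-- The state of the machine: registers with fixed addresses, and a memory that is addressed
indirectly. All cells hold natural numbers. -/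
structure RAMState where
  reg : ℕ → ℕ
  mem : ℕ → ℕ

/-- The cost of handling the number `n`: its length in binary, plus one. -/
def logCost (n : ℕ) : ℕ := Nat.size n + 1

/-- Arithmetic expressions; subtraction is truncated at zero. -/
inductive Expr where
  | lit (n : ℕ)
  | reg (i : ℕ)
  | mem (e : Expr)
  | add (e f : Expr)
  | sub (e f : Expr)
  | mul (e f : Expr)

def Expr.eval (st : RAMState) : Expr → ℕ
  | lit n => n
  | reg i => st.reg i
  | mem e => st.mem (e.eval st)
  | add e f => e.eval st + f.eval st
  | sub e f => e.eval st - f.eval st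
  | mul e f => e.eval st * f.eval st

/-- The logarithmic cost of evaluating an expression: every operand, address and intermediate
result is charged its length in binary. -/
def Expr.cost (st : RAMState) : Expr → ℕ
  | lit n => logCost n
  | reg i => logCost i + logCost (st.reg i)
  | mem e => e.cost st + logCost (st.mem (e.eval st))
  | add e f => e.cost st + f.cost st + logCost (e.eval st + f.eval st)
  | sub e f => e.cost st + f.cost st + logCost (e.eval st - f.eval st)
  | mul e f => e.cost st + f.cost st + logCost (e.eval st * f.eval st)

/-- Programs. Tests succeed when the expression is nonzero. -/
inductive Prog where
  | skip
  | assign (i : ℕ) (e : Expr)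
  | store (e f : Expr)
  | seq (c d : Prog)
  | cond (e : Expr) (c d : Prog)
  | loop (e : Expr) (c : Prog)

/-- `Exec c st n st'`: the program `c`, started in state `st`, halts in state `st'`, with
total cost `n`. -/
inductive Exec : Prog → RAMState → ℕ → RAMState → Prop where
  | skip (st) : Exec .skip st 1 st
  | assign (st i e) :
      Exec (.assign i e) st (e.cost st + logCost i)
        { st with reg := Function.update st.reg i (e.eval st) }
  | store (st e f) :
      Exec (.store e f) st (e.cost st + f.cost st)
        { st with mem := Function.update st.mem (e.eval st) (f.eval st) }
  | seq {c d st st₁ st₂ m n} : Exec c st m st₁ → Exec d st₁ n st₂ → Exec (.seq c d) st (m + n) st₂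
  | cond_true {e c d st st₁ n} : e.eval st ≠ 0 → Exec c st n st₁ →
      Exec (.cond e c d) st (e.cost st + n) st₁
  | cond_false {e c d st st₁ n} : e.eval st = 0 → Exec d st n st₁ →
      Exec (.cond e c d) st (e.cost st + n) st₁
  | loop_false {e c st} : e.eval st = 0 → Exec (.loop e c) st (e.cost st) st
  | loop_true {e c st st₁ st₂ m n} : e.eval st ≠ 0 → Exec c st m st₁ → Exec (.loop e c) st₁ n st₂ →
      Exec (.loop e c) st (e.cost st + m + n) st₂

/-- The initial state: the input is in the memory cells `0, 1, …`, its number of entries is in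
register `0`, and everything else is zero. -/
def RAMState.ofInput (l : List ℕ) : RAMState where
  reg := Function.update 0 0 l.length
  mem := fun i => l.getD i 0

/-- The size of an input: the total binary length of its entries, plus one per entry. -/
def inputSize (l : List ℕ) : ℕ := (l.map logCost).sum

open Classical in
/-- The decision problem `Q`, whose instances `x` are presented to the machine as `enc x` and
have numerical parameter `K x`, is solved by an algorithm (a single program, with output in
register `0`) whose running time is polynomial in `K x` and the size of the instance. -/
def PseudopolynomialTime {ι : Type*} (enc : ι → List ℕ) (K : ι → ℕ) (Q : ι → Prop) : Prop :=
  ∃ (c : Prog) (P : Polynomial ℕ), ∀ x, ∃ (n : ℕ) (st : RAMState),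
    Exec c (RAMState.ofInput (enc x)) n st ∧ n ≤ P.eval (K x + inputSize (enc x)) ∧
      st.reg 0 = if Q x then 1 else 0

/-! ### Instances with integer rewards -/

/-- An MDP with integer rewards, as an input to an algorithm: the states and the actions available
at each state are numbered. -/
structure IntegerMDP where
  numStates : ℕ
  numActions : Fin numStates → ℕ
  mdp : MDP (Fin numStates) (fun s => Fin (numActions s))
  integer_rewards : ∀ r ∈ mdp.R, ∃ z : ℤ, r = z

namespace IntegerMDP

/-- The maximal absolute value of a reward; it is an integer, so rounding up has no effect. -/
def K (x : IntegerMDP) : ℕ := x.mdp.R.sup fun r => ⌈|r|⌉₊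

/-- A rational number is given by its sign, and its numerator and denominator in binary. -/
def encodeRat (q : ℚ) : List ℕ := [if q < 0 then 1 else 0, q.num.natAbs, q.den]

/-- The possible rewards, in increasing order. -/
def rewardList (x : IntegerMDP) : List x.mdp.R :=
  (List.finRange x.mdp.R.card).map (x.mdp.R.orderIsoOfFin rfl)

/-- The list of all the data of the MDP: the horizon, the number of states, the initial state, the
numbers of actions, the number of rewards, the rewards, and the tables of `p` and `g`. -/
def encode (x : IntegerMDP) : List ℕ :=
  [x.mdp.T, x.numStates, (x.mdp.init : ℕ)] ++ List.ofFn x.numActions ++ [x.mdp.R.card] ++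
  (x.rewardList.flatMap fun r => encodeRat r) ++
  (List.finRange x.mdp.T).flatMap fun t =>
    (List.finRange x.numStates).flatMap fun s =>
      (List.finRange (x.numActions s)).flatMap fun a =>
        ((List.finRange x.numStates).flatMap fun s' => encodeRat (x.mdp.p t s a s')) ++
        (x.rewardList.flatMap fun r => encodeRat (x.mdp.g t s a r))

end IntegerMDP

end MeanVariance

end

open MeasureTheory ProbabilityTheory
open scoped unitInterval

namespace MeanVariance

/-! ### Zero variance as a condition on supports -/

namespace MDP

variable {S : Type*} [Fintype S] {A : S → Type*} (M : MDP S A)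

/-! The total reward takes finitely many values, so its variance vanishes exactly if it equals one
constant `c` on all trajectories of positive probability (`V_eq_zero_iff`). Only the supports of `p`
and `g` matter then, and randomization is useless: almost every realization `u` of the uniform
variables gives a deterministic rule that also yields `c` surely, and one such `u` can be fixed.

This leads to the predicate `Ensures t s c`, defined by backward recursion: some action at `s`
leads, for every possible reward `r` and next state `s'`, to `Ensures (t + 1) s' (c - r)`. A
zero-variance policy ensures some `c` from the initial state (`exists_ensures`). Conversely, an
action that keeps the remaining sum `c - w` ensured can be chosen from `t`, `s` and `w` alone, which
gives a policy in `PiTSW` (`exists_mem_piTSW`). This is (a).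

For (b), integer rewards with absolute values summing to `B` allow only integers `c` with `|c| ≤ T *
B`. The recursion is therefore evaluated in a table over time, state and sum, with sums shifted to
be nonnegative. Its size is pseudopolynomial: `B` is at most `K` times the number of rewards, and
`T` is at most the input length, because the data of every time step are listed (`horizon_le`).

The running time is estimated coarsely. If all cells keep length at most `b` and no loop takes more
than `b` rounds, a fixed program costs at most a polynomial in `b` (`Reaches`,
`Prog.exists_polynomial_weight`). All loops count a register down, so termination, cost and
correctness follow together from one invariant per loop (`Reaches.countdown`). -/

instance finite_history (t : ℕ) : Finite (M.History t) := by
  have := M.finite_actions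
  refine Finite.of_injective (β := (Fin t → M.Step) × S) (fun h => (h.steps, h.state)) ?_
  rintro ⟨a, b⟩ ⟨c, d⟩ h
  simpa using h

instance (t : ℕ) : DiscreteMeasurableSpace (M.History t) := ⟨fun _ => trivial⟩

theorem ratPMF_ne_zero {α : Type*} [Fintype α] (f : α → ℚ) (h0 h1) (a : α) :
    ratPMF f h0 h1 a ≠ 0 ↔ f a ≠ 0 := by
  have h := h0 a
  simp only [ratPMF, PMF.ofFintype_apply, ne_eq, ENNReal.ofReal_eq_zero, Rat.cast_nonpos]
  constructor
  · intro h2 h3; exact h2 h3.le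
  · intro h2 h3; exact h2 (le_antisymm h3 h)

variable {M}

theorem History.W_extend {t : ℕ} (h : M.History t) (a : A h.state) (r : M.R) (s' : S) :
    (h.extend a r s').W = h.W + r := by
  simp [History.W, History.extend, Fin.sum_univ_castSucc]

/-- A history has positive probability at time `t + 1` exactly if it extends one of positive
probability at time `t` by a reward and a state that are possible under the chosen action. -/
theorem law_succ_ne_zero (π : M.Policy) (u : Fin M.T → I) {t : ℕ} (ht : t + 1 ≤ M.T)
    (h' : M.History (t + 1)) :
    M.law π u (t + 1) ht h' ≠ 0 ↔ ∃ h, M.law π u t (Nat.le_of_succ_le ht) h ≠ 0 ∧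
      ∃ r s', M.g ⟨t, ht⟩ h.state (π.act ⟨t, ht⟩ h (fun i => u (Fin.castLE ht i))) r ≠ 0 ∧
        M.p ⟨t, ht⟩ h.state (π.act ⟨t, ht⟩ h (fun i => u (Fin.castLE ht i))) s' ≠ 0 ∧
        h' = h.extend (π.act ⟨t, ht⟩ h (fun i => u (Fin.castLE ht i))) r s' := by
  rw [← PMF.mem_support_iff, law]
  simp only [PMF.mem_support_bind_iff, PMF.support_map, Set.mem_image]
  simp only [PMF.mem_support_iff, ratPMF_ne_zero]
  constructor
  · rintro ⟨h, hh, r, hr, s', hs, rfl⟩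
    exact ⟨h, hh, r, s', hr, hs, rfl⟩
  · rintro ⟨h, hh, r, s', hr, hs, rfl⟩
    exact ⟨h, hh, r, hr, s', hs, rfl⟩

/-- At each step `u` enters only through the chosen action, a measurable map into a finite set.
Measurability is what turns a vanishing integral over `u` into vanishing for almost every `u`. -/
theorem measurable_law (π : M.Policy) (t : ℕ) (ht : t ≤ M.T) (h : M.History t) :
    Measurable fun u => M.law π u t ht h := by
  induction t with
  | zero => exact measurable_const
  | succ t ih =>
    simp only [law, PMF.bind_apply]
    refine Measurable.tsum fun h' => (ih _ h').mul ?_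
    have := M.finite_actions h'.state
    let : MeasurableSpace (A h'.state) := ⊤
    have hact : Measurable fun u : Fin M.T → I =>
        π.act ⟨t, ht⟩ h' (fun i => u (Fin.castLE ht i)) := by
      refine measurable_to_countable' fun a => ?_
      have h1 : Measurable fun (u : Fin M.T → I) (i : Fin (t + 1)) => u (Fin.castLE ht i) := by
        fun_prop
      exact h1 (π.measurable_act ⟨t, ht⟩ h' a)
    exact (measurable_from_top (f := fun a : A h'.state => ∑' r : M.R,
      ratPMF (M.g ⟨t, ht⟩ h'.state a) (M.g_nonneg _ _ _) (M.g_sum _ _ _) r *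
        ((ratPMF (M.p ⟨t, ht⟩ h'.state a) (M.p_nonneg _ _ _) (M.p_sum _ _ _)).map fun s' =>
          h'.extend a r s') h)).comp hact

instance isProbabilityMeasure_trajLaw (π : M.Policy) : IsProbabilityMeasure (M.trajLaw π) := by
  constructor
  rw [trajLaw, Measure.sum_apply _ MeasurableSet.univ]
  simp only [Measure.smul_apply, measure_univ, smul_eq_mul, mul_one, trajProb]
  rw [← lintegral_tsum fun τ => (measurable_law π _ _ τ).aemeasurable]
  simp [PMF.tsum_coe]

theorem ae_trajLaw_iff (π : M.Policy) (P : M.History M.T → Prop) :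
    (∀ᵐ τ ∂M.trajLaw π, P τ) ↔ ∀ τ, M.trajProb π τ ≠ 0 → P τ := by
  rw [trajLaw, Measure.ae_sum_iff' (MeasurableSet.of_discrete)]
  refine forall_congr' fun τ => ?_
  by_cases h : M.trajProb π τ = 0
  · simp [h]
  · rw [Measure.ae_ennreal_smul_measure_iff h, ae_dirac_iff MeasurableSet.of_discrete]
    simp [h]

theorem V_eq_zero_iff (π : M.Policy) :
    M.V π = 0 ↔ ∃ c : ℚ, ∀ τ, M.trajProb π τ ≠ 0 → τ.W = c := by
  have hm : MemLp (fun τ : M.History M.T => (τ.W : ℝ)) 2 (M.trajLaw π) := by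
    obtain ⟨C, hC⟩ := (Set.finite_range fun τ : M.History M.T => ‖(τ.W : ℝ)‖).bddAbove
    exact MemLp.of_bound Measurable.of_discrete.aestronglyMeasurable C
      (Filter.Eventually.of_forall fun τ => hC ⟨τ, rfl⟩)
  constructor
  · intro h
    have h1 : ∀ᵐ τ ∂M.trajLaw π, (τ.W : ℝ) = ∫ τ, (τ.W : ℝ) ∂M.trajLaw π :=
      ae_eq_integral_of_variance_eq_zero hm h
    -- An almost sure event is nonempty, so the mean is itself a value of `W`, hence rational.
    have h2 : ∃ τ : M.History M.T, (τ.W : ℝ) = ∫ τ, (τ.W : ℝ) ∂M.trajLaw π := h1.exists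
    obtain ⟨τ₀, h0⟩ := h2
    refine ⟨τ₀.W, fun τ hτ => ?_⟩
    have := (ae_trajLaw_iff π _).1 h1 τ hτ
    exact_mod_cast this.trans h0.symm
  · rintro ⟨c, hc⟩
    have h1 : (fun τ : M.History M.T => (τ.W : ℝ)) =ᵐ[M.trajLaw π] fun _ => (c : ℝ) :=
      (ae_trajLaw_iff π _).2 fun τ hτ => by simp only [hc τ hτ]
    rw [V, variance_congr h1]
    simp [variance_eq_integral]

/-- From the state `s` at time `t`, it can be ensured that the remaining rewards sum to `c`. -/
def Ensures (M : MDP S A) (t : ℕ) (s : S) (c : ℚ) : Prop :=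
  if ht : t < M.T then ∃ a : A s, ∀ r : M.R, M.g ⟨t, ht⟩ s a r ≠ 0 →
    ∀ s', M.p ⟨t, ht⟩ s a s' ≠ 0 → M.Ensures (t + 1) s' (c - r)
  else c = 0
termination_by M.T - t

theorem ensures_of_lt {t : ℕ} (ht : t < M.T) (s : S) (c : ℚ) :
    M.Ensures t s c ↔ ∃ a : A s, ∀ r : M.R, M.g ⟨t, ht⟩ s a r ≠ 0 →
      ∀ s', M.p ⟨t, ht⟩ s a s' ≠ 0 → M.Ensures (t + 1) s' (c - r) := by
  rw [Ensures, dif_pos ht]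

theorem ensures_horizon (s : S) (c : ℚ) : M.Ensures M.T s c ↔ c = 0 := by
  rw [Ensures, dif_neg (lt_irrefl _)]

/-- A policy with zero variance ensures a constant total reward. -/
theorem exists_ensures (π : M.Policy) (hπ : M.V π = 0) : ∃ c, M.Ensures 0 M.init c := by
  obtain ⟨c, hc⟩ := (V_eq_zero_iff π).1 hπ
  refine ⟨c, ?_⟩
  -- A trajectory of total probability zero has probability zero for almost every `u`. There are
  -- finitely many trajectories, so one `u` serves for all of them.
  have h1 : ∀ᵐ u : Fin M.T → I, ∀ τ, M.law π u M.T le_rfl τ ≠ 0 → τ.W = c := by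
    rw [ae_all_iff]
    intro τ
    by_cases hτ : M.trajProb π τ = 0
    · rw [trajProb, lintegral_eq_zero_iff (measurable_law π _ _ τ)] at hτ
      filter_upwards [hτ] with u hu h
      exact absurd hu h
    · exact Filter.Eventually.of_forall fun _ _ => hc τ hτ
  obtain ⟨u, hu⟩ := h1.exists
  -- Backward induction, with `d` the remaining time; the witness for `Ensures` is the action that
  -- `π` takes under the fixed `u`.
  have key : ∀ d t (ht : t ≤ M.T), t + d = M.T → ∀ h : M.History t,
      M.law π u t ht h ≠ 0 → M.Ensures t h.state (c - h.W) := by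
    intro d
    induction d with
    | zero =>
      intro t ht htd h hh
      obtain rfl : t = M.T := by omega
      rw [ensures_horizon, hu h hh, sub_self]
    | succ d ih =>
      intro t ht htd h hh
      have ht' : t < M.T := by omega
      rw [ensures_of_lt ht']
      refine ⟨π.act ⟨t, ht'⟩ h fun i => u (Fin.castLE ht' i), fun r hr s' hs => ?_⟩
      have := ih (t + 1) ht' (by omega) (h.extend _ r s')
        ((law_succ_ne_zero π u ht' _).2 ⟨h, hh, r, s', hr, hs, rfl⟩)
      rw [History.W_extend] at this
      rw [sub_sub]
      exact this
  have := key M.T 0 (Nat.zero_le _) (by simp) ⟨Fin.elim0, M.init⟩ (by simp [law])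
  simpa [History.W] using this

/-- If a constant total reward can be ensured, then a policy depending on the time, the state and
the cumulative reward has zero variance. -/
theorem exists_mem_piTSW {c : ℚ} (hc : M.Ensures 0 M.init c) : ∃ π ∈ M.PiTSW, M.V π = 0 := by
  -- The hypothesis stands inside the existential so that `μ` is total; where `c - w` cannot be
  -- ensured, the action is arbitrary.
  have hex : ∀ (t : Fin M.T) (s : S) (w : ℚ), ∃ a : A s, M.Ensures t s (c - w) →
      ∀ r : M.R, M.g t s a r ≠ 0 → ∀ s', M.p t s a s' ≠ 0 → M.Ensures (t + 1) s' (c - w - r) := by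
    intro t s w
    by_cases h : M.Ensures t s (c - w)
    · obtain ⟨a, ha⟩ := (ensures_of_lt t.2 s _).1 h
      exact ⟨a, fun _ => ha⟩
    · exact ⟨(M.nonempty_actions s).some, fun h' => absurd h' h⟩
  choose μ hμ using hex
  let π : M.Policy := ⟨fun t h _ => μ t h.state h.W, fun _ _ _ => MeasurableSet.const _⟩
  refine ⟨π, ⟨μ, fun _ _ _ => rfl⟩, (V_eq_zero_iff π).2 ⟨c, fun τ hτ => ?_⟩⟩
  -- Forward invariant: on every history of positive probability, the sum still missing from `c` is
  -- ensured. At the horizon it must be zero.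
  have key : ∀ u t (ht : t ≤ M.T) (h : M.History t),
      M.law π u t ht h ≠ 0 → M.Ensures t h.state (c - h.W) := by
    intro u t
    induction t with
    | zero =>
      intro ht h hh
      have : h = ⟨Fin.elim0, M.init⟩ := by
        by_contra hne
        simp [law, PMF.pure_apply, hne] at hh
      subst this
      simpa [History.W] using hc
    | succ t ih =>
      intro ht h' hh
      obtain ⟨h, hh', r, s', hr, hs, rfl⟩ := (law_succ_ne_zero π u ht h').1 hh
      rw [History.W_extend, ← sub_sub]
      exact hμ ⟨t, ht⟩ _ _ (ih _ h hh') r hr s' hs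
  have hu : ∃ u, M.law π u M.T le_rfl τ ≠ 0 := by
    by_contra! hcon
    exact hτ (by simp [trajProb, hcon])
  obtain ⟨u, hu⟩ := hu
  have := (ensures_horizon _ _).1 (key u _ _ τ hu)
  linarith

theorem exists_V_eq_zero_iff : (∃ π : M.Policy, M.V π = 0) ↔ ∃ c, M.Ensures 0 M.init c :=
  ⟨fun ⟨π, hπ⟩ => exists_ensures π hπ, fun ⟨_, hc⟩ =>
    let ⟨π, _, hπ⟩ := exists_mem_piTSW hc; ⟨π, hπ⟩⟩

/-- The sums that can be ensured are integers bounded by the remaining time times a bound on the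
rewards. -/
theorem Ensures.exists_int {B : ℕ} (hB : ∀ r ∈ M.R, ∃ z : ℤ, r = z ∧ |z| ≤ B) {d t : ℕ}
    (htd : t + d = M.T) {s : S} {c : ℚ} (h : M.Ensures t s c) :
    ∃ z : ℤ, c = z ∧ |z| ≤ d * B := by
  induction d generalizing t s c with
  | zero =>
    obtain rfl : t = M.T := by omega
    exact ⟨0, by simpa using (ensures_horizon _ _).1 h, by simp⟩
  | succ d ih =>
    have ht : t < M.T := by omega
    obtain ⟨a, ha⟩ := (ensures_of_lt ht _ _).1 h
    -- Probabilities sum to one, so some branch is possible; a single branch already determines `c`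
    -- up to the bound.
    obtain ⟨r, -, hr⟩ : ∃ r ∈ Finset.univ, M.g ⟨t, ht⟩ s a r ≠ 0 :=
      Finset.exists_ne_zero_of_sum_ne_zero (by rw [M.g_sum]; simp)
    obtain ⟨s', -, hs⟩ : ∃ s' ∈ Finset.univ, M.p ⟨t, ht⟩ s a s' ≠ 0 :=
      Finset.exists_ne_zero_of_sum_ne_zero (by rw [M.p_sum]; simp)
    obtain ⟨z, hz, hzb⟩ := ih (by omega) (ha r hr s' hs)
    obtain ⟨w, hw, hwb⟩ := hB r r.2
    refine ⟨z + w, ?_, ?_⟩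
    · push_cast; linarith
    · refine (abs_add_le _ _).trans ?_
      push_cast; linarith

end MDP

/-! ### Cost analysis of programs -/

theorem logCost_le_succ (n : ℕ) : logCost n ≤ n + 1 :=
  Nat.succ_le_succ (Nat.size_le.2 n.lt_two_pow_self)

theorem logCost_mono {m n : ℕ} (h : m ≤ n) : logCost m ≤ logCost n :=
  Nat.succ_le_succ (Nat.size_le_size h)

theorem logCost_add (m n : ℕ) : logCost (m + n) ≤ logCost m + logCost n := by
  -- The extra bit is absorbed by the `+ 1` in each `logCost` on the right.
  have h : Nat.size (m + n) ≤ m.size + n.size + 1 := by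
    rw [Nat.size_le]
    have h1 := m.lt_size_self
    have h2 := n.lt_size_self
    have h3 : 2 ^ m.size ≤ 2 ^ (m.size + n.size) := Nat.pow_le_pow_right (by norm_num) (by omega)
    have h4 : 2 ^ n.size ≤ 2 ^ (m.size + n.size) := Nat.pow_le_pow_right (by norm_num) (by omega)
    rw [pow_succ]
    omega
  unfold logCost
  omega

theorem logCost_mul (m n : ℕ) : logCost (m * n) ≤ logCost m + logCost n := by
  have h : Nat.size (m * n) ≤ m.size + n.size := by
    rw [Nat.size_le, pow_add]
    exact Nat.mul_lt_mul'' m.lt_size_self n.lt_size_self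
  unfold logCost
  omega

/-- All cells of the machine have length at most `b`. -/
def RAMState.Bounded (b : ℕ) (st : RAMState) : Prop :=
  (∀ i, logCost (st.reg i) ≤ b) ∧ ∀ i, logCost (st.mem i) ≤ b

theorem RAMState.Bounded.one_le {b : ℕ} {st : RAMState} (h : st.Bounded b) : 1 ≤ b :=
  le_trans (Nat.succ_le_succ (Nat.zero_le _)) (h.1 0)

/-- The length of the value of an expression, relative to the length of the cells. -/
def Expr.width : Expr → ℕ
  | lit n => logCost n
  | reg _ => 1
  | mem _ => 1
  | add e f => e.width + f.width
  | sub e f => e.width + f.width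
  | mul e f => e.width + f.width

/-- The cost of evaluating an expression, relative to the length of the cells. -/
def Expr.weight : Expr → ℕ
  | lit n => logCost n
  | reg i => logCost i + 1
  | mem e => e.weight + 1
  | add e f => e.weight + f.weight + (e.width + f.width)
  | sub e f => e.weight + f.weight + (e.width + f.width)
  | mul e f => e.weight + f.weight + (e.width + f.width)

theorem Expr.logCost_eval_le {b : ℕ} {st : RAMState} (h : st.Bounded b) (e : Expr) :
    logCost (e.eval st) ≤ e.width * b := by
  induction e with
  | lit n => exact Nat.le_mul_of_pos_right _ h.one_le
  | reg i => simpa [width, eval] using h.1 i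
  | mem e _ => simpa [width, eval] using h.2 _
  | add e f he hf =>
    rw [width, add_mul]
    exact (logCost_add _ _).trans (add_le_add he hf)
  | sub e f he hf =>
    rw [width, add_mul]
    exact (logCost_mono (Nat.sub_le _ _)).trans (he.trans (Nat.le_add_right _ _))
  | mul e f he hf =>
    rw [width, add_mul]
    exact (logCost_mul _ _).trans (add_le_add he hf)

theorem Expr.cost_le {b : ℕ} {st : RAMState} (h : st.Bounded b) (e : Expr) :
    e.cost st ≤ e.weight * b := by
  have h1 := h.one_le
  induction e with
  | lit n => exact Nat.le_mul_of_pos_right _ h1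
  | reg i =>
    rw [weight, add_mul, one_mul]
    exact add_le_add (Nat.le_mul_of_pos_right _ h1) (h.1 i)
  | mem e he =>
    rw [weight, add_mul, one_mul]
    exact add_le_add he (h.2 _)
  | add e f he hf =>
    rw [weight, add_mul, add_mul]
    exact add_le_add (add_le_add he hf) (logCost_eval_le h (.add e f))
  | sub e f he hf =>
    rw [weight, add_mul, add_mul]
    exact add_le_add (add_le_add he hf) (logCost_eval_le h (.sub e f))
  | mul e f he hf =>
    rw [weight, add_mul, add_mul]
    exact add_le_add (add_le_add he hf) (logCost_eval_le h (.mul e f))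

/-- The cost of a program, relative to the length of the cells, if no loop takes more than `N`
rounds. -/
def Prog.weight (N : ℕ) : Prog → ℕ
  | skip => 1
  | assign i e => e.weight + logCost i
  | store e f => e.weight + f.weight
  | seq c d => c.weight N + d.weight N
  | cond e c d => e.weight + (c.weight N + d.weight N)
  | loop e c => N * (e.weight + c.weight N) + e.weight

/-- The loop structure of a program is fixed, and each loop only multiplies by `N`. This provides
one polynomial for all instances. -/
theorem Prog.exists_polynomial_weight (c : Prog) :
    ∃ P : Polynomial ℕ, ∀ N, c.weight N = P.eval N := by
  induction c with
  | skip => exact ⟨1, by simp [weight]⟩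
  | assign i e => exact ⟨Polynomial.C (e.weight + logCost i), by simp [weight]⟩
  | store e f => exact ⟨Polynomial.C (e.weight + f.weight), by simp [weight]⟩
  | seq c d hc hd =>
    obtain ⟨P, hP⟩ := hc
    obtain ⟨Q, hQ⟩ := hd
    exact ⟨P + Q, by simp [weight, hP, hQ]⟩
  | cond e c d hc hd =>
    obtain ⟨P, hP⟩ := hc
    obtain ⟨Q, hQ⟩ := hd
    exact ⟨Polynomial.C e.weight + (P + Q), by simp [weight, hP, hQ]⟩
  | loop e c hc =>
    obtain ⟨P, hP⟩ := hc
    exact ⟨Polynomial.X * (Polynomial.C e.weight + P) + Polynomial.C e.weight,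
      by simp [weight, hP]⟩

/-- Started in `st`, the program `c` halts in a state satisfying `Q`; if the cells of `st` have
length at most `b`, this remains so and the cost is at most that of at most `N` rounds for each
loop. -/
def Reaches (b N : ℕ) (c : Prog) (st : RAMState) (Q : RAMState → Prop) : Prop :=
  st.Bounded b → ∃ n st', Exec c st n st' ∧ n ≤ c.weight N * b ∧ st'.Bounded b ∧ Q st'

namespace Reaches

variable {b N : ℕ} {st : RAMState} {Q : RAMState → Prop}

theorem mono {c : Prog} {Q' : RAMState → Prop} (h : Reaches b N c st Q)
    (hQ : ∀ st', Q st' → Q' st') : Reaches b N c st Q' := by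
  intro hb
  obtain ⟨n, st', h1, h2, h3, h4⟩ := h hb
  exact ⟨n, st', h1, h2, h3, hQ _ h4⟩

theorem seq {c d : Prog} (h : Reaches b N c st fun st' => Reaches b N d st' Q) :
    Reaches b N (.seq c d) st Q := by
  intro hb
  obtain ⟨n, st', h1, h2, h3, h4⟩ := h hb
  obtain ⟨m, st'', k1, k2, k3, k4⟩ := h4 h3
  refine ⟨n + m, st'', .seq h1 k1, ?_, k3, k4⟩
  rw [Prog.weight, add_mul]
  exact add_le_add h2 k2

theorem assign {i : ℕ} {e : Expr} (hv : logCost (e.eval st) ≤ b)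
    (hQ : Q { st with reg := Function.update st.reg i (e.eval st) }) :
    Reaches b N (.assign i e) st Q := by
  intro hb
  refine ⟨_, _, .assign st i e, ?_, ⟨fun j => ?_, hb.2⟩, hQ⟩
  · rw [Prog.weight, add_mul]
    exact add_le_add (e.cost_le hb) (Nat.le_mul_of_pos_right _ hb.one_le)
  · by_cases h : j = i
    · subst h; simpa using hv
    · simpa [h] using hb.1 j

theorem store {e f : Expr} (hv : logCost (f.eval st) ≤ b)
    (hQ : Q { st with mem := Function.update st.mem (e.eval st) (f.eval st) }) :
    Reaches b N (.store e f) st Q := by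
  intro hb
  refine ⟨_, _, .store st e f, ?_, ⟨hb.1, fun j => ?_⟩, hQ⟩
  · rw [Prog.weight, add_mul]
    exact add_le_add (e.cost_le hb) (f.cost_le hb)
  · by_cases h : j = e.eval st
    · subst h; simpa using hv
    · simpa [h] using hb.2 j

end Reaches

/-- A loop that counts the register `i` down to zero. -/
def Prog.countdown (i : ℕ) (c : Prog) : Prog :=
  .loop (.reg i) (.seq (.assign i (.sub (.reg i) (.lit 1))) c)

/-- `Inv q` describes the moment of the test with `q` rounds left. The counter is decremented before
the body runs, so the body starts with the value `q` and turns `Inv (q + 1)` into `Inv q`; by `hreg`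
it must end with the counter still at `q`. -/
theorem Reaches.countdown {b N : ℕ} {st : RAMState} {Q : RAMState → Prop} {i : ℕ} {c : Prog}
    (Inv : ℕ → RAMState → Prop) {k : ℕ} (hk : k ≤ N) (h0 : Inv k st)
    (hreg : ∀ q st, Inv q st → st.reg i = q)
    (hstep : ∀ q < k, ∀ st, Inv (q + 1) st →
      Reaches b N c { st with reg := Function.update st.reg i q } (Inv q))
    (hQ : ∀ st, Inv 0 st → Q st) : Reaches b N (.countdown i c) st Q := by
  have key : ∀ q ≤ k, ∀ st, Inv q st → st.Bounded b → ∃ n st', Exec (.countdown i c) st n st' ∧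
      n ≤ (q * ((Expr.reg i).weight +
        (Prog.seq (.assign i (.sub (.reg i) (.lit 1))) c).weight N) + (Expr.reg i).weight) * b ∧
      st'.Bounded b ∧ Inv 0 st' := by
    intro q
    induction q with
    | zero =>
      intro _ st hI hb
      refine ⟨_, _, .loop_false (hreg _ _ hI), ?_, hb, hI⟩
      simpa using (Expr.reg i).cost_le hb
    | succ q ih =>
      intro hq st hI hb
      have hr := hreg _ _ hI
      have hbody : Reaches b N (.seq (.assign i (.sub (.reg i) (.lit 1))) c) st (Inv q) := by
        refine .seq (.assign ?_ ?_)
        · exact (logCost_mono (Nat.sub_le _ _)).trans (hb.1 i)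
        · have := hstep q hq st hI
          simpa [Expr.eval, hr] using this
      obtain ⟨n, st', h1, h2, h3, h4⟩ := hbody hb
      obtain ⟨m, st'', k1, k2, k3, k4⟩ := ih (by omega) st' h4 h3
      refine ⟨_, _, .loop_true (by simp [Expr.eval, hr]) h1 k1, ?_, k3, k4⟩
      have := (Expr.reg i).cost_le hb
      calc _ ≤ _ := add_le_add (add_le_add this h2) k2
        _ = _ := by ring
  intro hb
  obtain ⟨n, st', h1, h2, h3, h4⟩ := key k le_rfl st h0 hb
  refine ⟨n, st', h1, h2.trans ?_, h3, hQ _ h4⟩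
  simp only [Prog.countdown, Prog.weight]
  gcongr

/-! ### The algorithm -/

instance : Add Expr := ⟨.add⟩
instance : Sub Expr := ⟨.sub⟩
instance : Mul Expr := ⟨.mul⟩
instance (n : ℕ) : OfNat Expr n := ⟨.lit n⟩

/-- The machine state whose registers are listed in `l` and whose memory is `μ`. -/
def listState (l : List ℕ) (μ : ℕ → ℕ) : RAMState := ⟨fun i => l.getD i 0, μ⟩

theorem listState_update {l : List ℕ} {i : ℕ} (hi : i < l.length) (μ : ℕ → ℕ) (v : ℕ) :
    { listState l μ with reg := Function.update (listState l μ).reg i v } =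
      listState (l.set i v) μ := by
  simp only [listState, RAMState.mk.injEq, and_true]
  funext j
  by_cases h : j = i
  · subst h; simp [List.getD, hi]
  · rw [Function.update_of_ne h, List.getD, List.getD, List.getElem?_set_ne (Ne.symm h)]

/-- The side condition bounds the value itself and not only its length. This loses nothing here: `b`
will be pseudopolynomial and dominates every number the algorithm writes. -/
theorem Reaches.assign_list {b N : ℕ} {Q : RAMState → Prop} {l : List ℕ} {μ : ℕ → ℕ} {i : ℕ}
    {e : Expr} (v : ℕ) (hi : i < l.length) (hv : e.eval (listState l μ) = v) (hb : v + 1 ≤ b)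
    (hQ : Q (listState (l.set i v) μ)) : Reaches b N (.assign i e) (listState l μ) Q := by
  subst hv
  exact .assign ((logCost_le_succ _).trans hb) (by rwa [listState_update hi])

theorem Reaches.store_list {b N : ℕ} {Q : RAMState → Prop} {l : List ℕ} {μ : ℕ → ℕ}
    {e f : Expr} (u v : ℕ) (hu : e.eval (listState l μ) = u) (hv : f.eval (listState l μ) = v)
    (hb : v + 1 ≤ b) (hQ : Q (listState l (Function.update μ u v))) :
    Reaches b N (.store e f) (listState l μ) Q := by
  subst hu hv
  exact .store ((logCost_le_succ _).trans hb) hQ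

/-- `for i := e - 1, …, 0 do c` -/
def Prog.forDown (i : ℕ) (e : Expr) (c : Prog) : Prog := .seq (.assign i e) (.countdown i c)

theorem Reaches.forDown_list {b : ℕ} {Q : RAMState → Prop} {l : List ℕ} {μ : ℕ → ℕ} {i : ℕ}
    {e : Expr} {c : Prog} (k : ℕ) (Inv : ℕ → List ℕ → (ℕ → ℕ) → Prop) (hi : i < l.length)
    (he : e.eval (listState l μ) = k) (hk : k + 1 ≤ b) (h0 : Inv k (l.set i k) μ)
    (hreg : ∀ q l μ, Inv q l μ → i < l.length ∧ l.getD i 0 = q)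
    (hstep : ∀ q < k, ∀ l μ, Inv (q + 1) l μ → Reaches b b c (listState (l.set i q) μ)
      fun st => ∃ l μ, st = listState l μ ∧ Inv q l μ)
    (hQ : ∀ l μ, Inv 0 l μ → Q (listState l μ)) :
    Reaches b b (.forDown i e c) (listState l μ) Q := by
  refine .seq (.assign_list k hi he hk ?_)
  refine .countdown (k := k) (fun q st => ∃ l μ, st = listState l μ ∧ Inv q l μ) (by omega)
    ⟨_, _, rfl, h0⟩ ?_ ?_ ?_
  · rintro q _ ⟨l, μ, rfl, h⟩
    exact (hreg q l μ h).2
  · rintro q hq _ ⟨l, μ, rfl, h⟩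
    rw [listState_update (hreg _ _ _ h).1]
    exact hstep q hq l μ h
  · rintro _ ⟨l, μ, rfl, h⟩
    exact hQ l μ h

/-- The layout of an instance in the memory, as used by the algorithm. The rewards are described in
the cells from `4 + n` on; `pos t s a` is the address of the tables of the probabilities for the
time `t`, the state `s` and the action `a`. The predicate `E t s k` says that a total reward of
`k - (T + 1) * B` can be ensured from the state `s` at time `t`. -/
structure Layout where
  inp : ℕ → ℕ
  len : ℕ
  T : ℕ
  n : ℕ
  m : ℕ
  B : ℕ
  pos : ℕ → ℕ → ℕ → ℕ
  E : ℕ → ℕ → ℕ → Prop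
  inp_zero : inp 0 = T
  inp_one : inp 1 = n
  init_lt : inp 2 < n
  inp_m : inp (3 + n) = m
  le_len : 4 + n + 3 * m ≤ len
  row_le : 3 * (n + m) ≤ len
  T_le : T ≤ len
  actions_le : ∀ s < n, inp (3 + s) ≤ len
  sum_mag : ∑ j ∈ Finset.range m, inp (4 + n + 3 * j + 1) = B
  sgn_le : ∀ j < m, inp (4 + n + 3 * j) ≤ 1
  pos_T : pos T 0 0 = len
  pos_time : ∀ t < T, pos t n 0 = pos (t + 1) 0 0
  pos_state : ∀ t < T, ∀ s < n, pos t s (inp (3 + s)) = pos t (s + 1) 0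
  pos_action : ∀ t < T, ∀ s < n, ∀ a < inp (3 + s), pos t s (a + 1) = pos t s a + 3 * (n + m)
  pos_le : ∀ t < T, ∀ s < n, ∀ a < inp (3 + s), pos t s a + 3 * (n + m) ≤ len
  E_T : ∀ s < n, ∀ k ≤ 2 * ((T + 1) * B), E T s k ↔ k = (T + 1) * B
  -- With a sign bit that is `1` for negative rewards, adding twice the magnitude in that case and
  -- then subtracting it once gives `k - r`; truncation does no harm since `B ≤ k`. The bounds on
  -- `k` say that the remaining sum has absolute value at most `T * B`. The table has a margin of
  -- `B` on either side, so `k - r` stays inside it.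
  E_lt : ∀ t < T, ∀ s < n, ∀ k ≤ 2 * ((T + 1) * B), E t s k ↔ ∃ a < inp (3 + s),
    B ≤ k ∧ k ≤ B + 2 * (T * B) ∧ ∀ j < m, ∀ s' < n,
      inp (pos t s a + 3 * n + 3 * j + 1) ≠ 0 → inp (pos t s a + 3 * s' + 1) ≠ 0 →
      E (t + 1) s' (k + 2 * inp (4 + n + 3 * j) * inp (4 + n + 3 * j + 1) -
        inp (4 + n + 3 * j + 1))

namespace Layout

variable (y : Layout)

/-- The number of cells for a given time and state. -/
def width : ℕ := 2 * ((y.T + 1) * y.B) + 1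

/-- The address of the cell for the time `t`, the state `s` and the sum `k`. -/
def addr (t s k : ℕ) : ℕ := y.len + (t * y.n + s) * y.width + k

/-- The successor condition for the reward `j` and the state `s'`. -/
def Ok (t s a k j s' : ℕ) : Prop :=
  y.inp (y.pos t s a + 3 * y.n + 3 * j + 1) ≠ 0 → y.inp (y.pos t s a + 3 * s' + 1) ≠ 0 →
    y.E (t + 1) s' (k + 2 * y.inp (4 + y.n + 3 * j) * y.inp (4 + y.n + 3 * j + 1) -
      y.inp (4 + y.n + 3 * j + 1))

/-- The memory contains the input, followed by the table of `F`. -/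
structure Holds (μ : ℕ → ℕ) (F : ℕ → ℕ → ℕ → Prop) : Prop where
  input : ∀ i < y.len, μ i = y.inp i
  le_one : ∀ t, ∀ s < y.n, ∀ k < y.width, μ (y.addr t s k) ≤ 1
  ne_zero_iff : ∀ t, ∀ s < y.n, ∀ k < y.width, μ (y.addr t s k) ≠ 0 ↔ F t s k

variable {y}

/-- The address is a mixed-radix expansion with digits `k` and `s`; the leading digit `t` needs no
bound. -/
theorem addr_inj {t s k t' s' k' : ℕ} (hs : s < y.n) (hk : k < y.width) (hs' : s' < y.n)
    (hk' : k' < y.width) (h : y.addr t s k = y.addr t' s' k') : t = t' ∧ s = s' ∧ k = k' := by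
  have h1 : (t * y.n + s) * y.width + k = (t' * y.n + s') * y.width + k' := by
    simp only [addr] at h; omega
  have aux : ∀ {w a b c d : ℕ}, b < w → d < w → a * w + b = c * w + d → a = c ∧ b = d := by
    intro w a b c d hb hd h
    have e1 : (a * w + b) / w = a := by
      rw [mul_comm, Nat.mul_add_div (by omega), Nat.div_eq_of_lt hb, add_zero]
    have e2 : (c * w + d) / w = c := by
      rw [mul_comm, Nat.mul_add_div (by omega), Nat.div_eq_of_lt hd, add_zero]
    have : a = c := by rw [← e1, h, e2]
    subst this
    exact ⟨rfl, by omega⟩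
  obtain ⟨h2, h3⟩ := aux hk hk' h1
  obtain ⟨h4, h5⟩ := aux hs hs' h2
  exact ⟨h4, h5, h3⟩

theorem Holds.congr {μ : ℕ → ℕ} {F G : ℕ → ℕ → ℕ → Prop} (h : y.Holds μ F)
    (hG : ∀ t, ∀ s < y.n, ∀ k < y.width, F t s k ↔ G t s k) : y.Holds μ G :=
  ⟨h.input, h.le_one, fun t s hs k hk => (h.ne_zero_iff t s hs k hk).trans (hG t s hs k hk)⟩

theorem Holds.update {μ : ℕ → ℕ} {F G : ℕ → ℕ → ℕ → Prop} (h : y.Holds μ F) {t s k v : ℕ}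
    (hs : s < y.n) (hk : k < y.width) (hv : v ≤ 1) (hvG : v ≠ 0 ↔ G t s k)
    (hG : ∀ t' s' k', s' < y.n → k' < y.width → ¬(t' = t ∧ s' = s ∧ k' = k) →
      (F t' s' k' ↔ G t' s' k')) :
    y.Holds (Function.update μ (y.addr t s k) v) G := by
  refine ⟨fun i hi => ?_, fun t' s' hs' k' hk' => ?_, fun t' s' hs' k' hk' => ?_⟩
  · rw [Function.update_of_ne, h.input i hi]
    simp only [addr]; omega
  · by_cases he : y.addr t' s' k' = y.addr t s k
    · rw [he, Function.update_self]; exact hv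
    · rw [Function.update_of_ne he]; exact h.le_one t' s' hs' k' hk'
  · by_cases he : y.addr t' s' k' = y.addr t s k
    · obtain ⟨rfl, rfl, rfl⟩ := addr_inj hs' hk' hs hk he
      rw [Function.update_self]; exact hvG
    · rw [Function.update_of_ne he, h.ne_zero_iff t' s' hs' k' hk']
      refine hG t' s' k' hs' hk' ?_
      rintro ⟨rfl, rfl, rfl⟩
      exact he rfl

variable (y) in
/-- The contents of the registers. -/
def regs (ptr t s a i j s' ok res : ℕ) : List ℕ :=
  [y.len, y.T, y.n, y.m, 3 * (y.n + y.m), y.B, y.width, ptr, t, s, a, i, j, s', ok, res]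

end Layout

namespace Prog

open MeanVariance.Expr

/-- The address of a cell of the table. -/
def cell (t s k : Expr) : Expr := reg 0 + (t * reg 2 + s) * reg 6 + k

/-- The absolute value of the reward `j`. -/
def mag : Expr := mem (4 + reg 2 + 3 * reg 12 + 1)

/-- Checks the condition for one reward and one successor state. -/
def checkSuccessor : Prog :=
  .assign 14 (reg 14 * (1 - mem (reg 7 + 3 * reg 2 + 3 * reg 12 + 1) *
    mem (reg 7 + 3 * reg 13 + 1) * (1 - mem (cell (reg 8 + 1) (reg 13)
      (reg 5 + reg 11 + 2 * mem (4 + reg 2 + 3 * reg 12) * mag - mag)))))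

/-- Computes one cell of the table, as far as one action is concerned. -/
def updateCell : Prog :=
  .seq (.assign 14 1) <|
  .seq (.forDown 12 (reg 3) (.forDown 13 (reg 2) checkSuccessor)) <|
  .store (cell (reg 8) (reg 9) (reg 5 + reg 11))
    (1 - (1 - (mem (cell (reg 8) (reg 9) (reg 5 + reg 11)) + reg 14)))

/-- Takes one action into account. -/
def processAction : Prog :=
  .seq (.assign 7 (reg 7 - reg 4)) (.forDown 11 (2 * (reg 1 * reg 5) + 1) updateCell)

/-- Computes the table. -/
def fillTable : Prog :=
  .forDown 8 (reg 1) (.forDown 9 (reg 2) (.forDown 10 (mem (3 + reg 9)) processAction))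

/-- Reads the parameters of the instance. -/
def readParameters : Prog :=
  .seq (.assign 1 (mem 0)) <|
  .seq (.assign 2 (mem 1)) <|
  .seq (.assign 3 (mem (3 + reg 2))) <|
  .seq (.assign 4 (3 * (reg 2 + reg 3))) <|
  .seq (.assign 7 (reg 0)) <|
  .seq (.forDown 12 (reg 3) (.assign 5 (reg 5 + mag))) <|
  .assign 6 (2 * ((reg 1 + 1) * reg 5) + 1)

/-- Sets the cells of the table for the horizon. -/
def initTable : Prog :=
  .forDown 9 (reg 2) (.store (cell (reg 1) (reg 9) ((reg 1 + 1) * reg 5)) 1)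

/-- Reads the answer off the table. -/
def readAnswer : Prog :=
  .seq (.forDown 11 (2 * (reg 1 * reg 5) + 1)
    (.assign 15 (1 - (1 - (reg 15 + mem (cell 0 (mem 2) (reg 5 + reg 11))))))) <|
  .assign 0 (reg 15)

/-- The decision procedure. -/
def decideZeroVariance : Prog :=
  .seq readParameters <| .seq initTable <| .seq fillTable readAnswer

end Prog
-- Correctness of the program, stage by stage
namespace Layout

open Prog

variable {y : Layout} {b : ℕ} {μ : ℕ → ℕ} {F : ℕ → ℕ → ℕ → Prop}

theorem mag_le {j : ℕ} (hj : j < y.m) : y.inp (4 + y.n + 3 * j + 1) ≤ y.B := by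
  rw [← y.sum_mag]
  exact Finset.single_le_sum (f := fun j => y.inp (4 + y.n + 3 * j + 1))
    (fun _ _ => Nat.zero_le _) (Finset.mem_range.2 hj)

theorem n_le : y.n ≤ y.len := by have := y.le_len; omega

theorem m_le : y.m ≤ y.len := by have := y.le_len; omega

theorem width_eq : y.width = 2 * (y.T * y.B) + 2 * y.B + 1 := by
  unfold width; ring

/-- The index of the cell that is looked up for the reward `j` lies in the table. -/
theorem index_lt {k j : ℕ} (hk : k ≤ y.B + 2 * (y.T * y.B)) (hj : j < y.m) :
    k + 2 * y.inp (4 + y.n + 3 * j) * y.inp (4 + y.n + 3 * j + 1) - y.inp (4 + y.n + 3 * j + 1)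
      < y.width := by
  have h1 := y.mag_le hj
  have h2 := y.sgn_le j hj
  rw [width_eq]
  interval_cases y.inp (4 + y.n + 3 * j) <;> omega

/-- Boolean logic in truncated arithmetic: `1 - z` vanishes exactly if `z ≠ 0`. Thus `g` and `p` can
be raw numerators of any size, and the flag is cleared precisely when both are nonzero and `e = 0`.
-/
theorem mul_one_sub_ne_zero {ok g p e : ℕ} {X : Prop} (he : e ≤ 1) (hX : e ≠ 0 ↔ X) :
    ok * (1 - g * p * (1 - e)) ≠ 0 ↔ ok ≠ 0 ∧ (g ≠ 0 → p ≠ 0 → X) := by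
  rw [← hX, mul_ne_zero_iff]
  refine and_congr_right fun _ => ?_
  rw [Nat.sub_ne_zero_iff_lt, Nat.lt_one_iff, mul_eq_zero, mul_eq_zero]
  interval_cases e
  · simp; tauto
  · simp

/-- Only the cells for time `t + 1` have to be final, so `F` is left free elsewhere and the
statement applies while the cells for time `t` are being filled. -/
theorem reaches_checkSuccessor (hb : y.width + y.len + 2 ≤ b) (hμ : y.Holds μ F)
    {t s a i j s' ok res : ℕ} (ht : t < y.T) (hs : s < y.n) (ha : a < y.inp (3 + s))
    (hF : ∀ s < y.n, ∀ k < y.width, F (t + 1) s k ↔ y.E (t + 1) s k)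
    (hi : i ≤ 2 * (y.T * y.B)) (hj : j < y.m) (hs' : s' < y.n) (hok : ok ≤ 1) :
    Reaches b b checkSuccessor (listState (y.regs (y.pos t s a) t s a i j s' ok res) μ) fun st =>
      ∃ ok' ≤ 1, st = listState (y.regs (y.pos t s a) t s a i j s' ok' res) μ ∧
        (ok' ≠ 0 ↔ ok ≠ 0 ∧ y.Ok t s a (y.B + i) j s') := by
  have hpos := y.pos_le t ht s hs a ha
  have hlen := y.le_len
  have hidx := y.index_lt (k := y.B + i) (by omega) hj
  set e := μ (y.addr (t + 1) s' (y.B + i + 2 * y.inp (4 + y.n + 3 * j) *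
    y.inp (4 + y.n + 3 * j + 1) - y.inp (4 + y.n + 3 * j + 1))) with he
  have h1 : e ≤ 1 := hμ.le_one _ _ hs' _ hidx
  have h2 := (hμ.ne_zero_iff (t + 1) _ hs' _ hidx).trans (hF _ hs' _ hidx)
  set v := ok * (1 - y.inp (y.pos t s a + 3 * y.n + 3 * j + 1) * y.inp (y.pos t s a + 3 * s' + 1) *
    (1 - e)) with hv
  have h3 : v ≤ 1 := Nat.mul_le_mul hok (Nat.sub_le _ _)
  refine .assign_list v (by simp [regs]) ?_ (by omega)
    ⟨v, h3, rfl, mul_one_sub_ne_zero h1 h2⟩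
  have e1 := hμ.input (y.pos t s a + 3 * y.n + 3 * j + 1) (by omega)
  have e2 := hμ.input (y.pos t s a + 3 * s' + 1) (by omega)
  have e3 := hμ.input (4 + y.n + 3 * j) (by omega)
  have e4 := hμ.input (4 + y.n + 3 * j + 1) (by omega)
  change ok * (1 - μ (y.pos t s a + 3 * y.n + 3 * j + 1) * μ (y.pos t s a + 3 * s' + 1) *
    (1 - μ (y.addr (t + 1) s' (y.B + i + 2 * μ (4 + y.n + 3 * j) * μ (4 + y.n + 3 * j + 1) -
      μ (4 + y.n + 3 * j + 1))))) = v
  rw [e1, e2, e3, e4]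

theorem reaches_updateCell (hb : y.width + y.len + 2 ≤ b) (hμ : y.Holds μ F)
    {t s a i ok res : ℕ} (ht : t < y.T) (hs : s < y.n) (ha : a < y.inp (3 + s))
    (hF : ∀ s < y.n, ∀ k < y.width, F (t + 1) s k ↔ y.E (t + 1) s k)
    (hi : i ≤ 2 * (y.T * y.B)) :
    Reaches b b updateCell (listState (y.regs (y.pos t s a) t s a i 0 0 ok res) μ) fun st =>
      ∃ ok' μ', st = listState (y.regs (y.pos t s a) t s a i 0 0 ok' res) μ' ∧
        y.Holds μ' fun t' s' k' => F t' s' k' ∨ t' = t ∧ s' = s ∧ k' = y.B + i ∧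
          ∀ j < y.m, ∀ s'' < y.n, y.Ok t s a (y.B + i) j s'' := by
  have hn := y.n_le
  have hm := y.m_le
  refine .seq (.assign_list 1 (by simp [regs]) rfl (by omega) (.seq ?_))
  refine .forDown_list (b := b) y.m (fun q l μ' => μ' = μ ∧ ∃ ok ≤ 1,
    l = y.regs (y.pos t s a) t s a i q 0 ok res ∧
      (ok ≠ 0 ↔ ∀ j, q ≤ j → j < y.m → ∀ s'' < y.n, y.Ok t s a (y.B + i) j s''))
    (by simp [regs]) rfl (by omega) ⟨rfl, 1, le_rfl, rfl, ?_⟩ ?_ ?_ ?_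
  · refine ⟨fun _ j h1 h2 => by omega, fun _ => one_ne_zero⟩
  · rintro q l μ' ⟨-, ok, -, rfl, -⟩
    exact ⟨by simp [regs], rfl⟩
  · rintro j hj l μ' ⟨rfl, ok, hok, rfl, hiff⟩
    refine .forDown_list (b := b) y.n (fun q l μ'' => μ'' = μ' ∧ ∃ ok' ≤ 1,
      l = y.regs (y.pos t s a) t s a i j q ok' res ∧
        (ok' ≠ 0 ↔ ok ≠ 0 ∧ ∀ s'', q ≤ s'' → s'' < y.n → y.Ok t s a (y.B + i) j s''))
      (by simp [regs]) rfl (by omega) ⟨rfl, ok, hok, rfl, ?_⟩ ?_ ?_ ?_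
    · refine ⟨fun h => ⟨h, fun j h1 h2 => by omega⟩, fun h => h.1⟩
    · rintro q l μ' ⟨-, ok, -, rfl, -⟩
      exact ⟨by simp [regs], rfl⟩
    · rintro s' hs' l μ'' ⟨rfl, ok', hok', rfl, hiff'⟩
      refine (reaches_checkSuccessor hb hμ ht hs ha hF hi hj hs' hok' (s' := s')).mono ?_
      rintro _ ⟨ok'', hok'', rfl, hiff''⟩
      refine ⟨_, _, rfl, rfl, ok'', hok'', rfl, ?_⟩
      rw [hiff'', hiff', and_assoc]
      refine and_congr_right fun _ => ⟨fun h s'' h1 h2 => ?_, fun h => ⟨fun s'' h1 h2 =>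
        h s'' (by omega) h2, h s' le_rfl hs'⟩⟩
      rcases Nat.eq_or_lt_of_le h1 with rfl | h3
      · exact h.2
      · exact h.1 s'' h3 h2
    · rintro l μ'' ⟨rfl, ok', hok', rfl, hiff'⟩
      refine ⟨_, _, rfl, rfl, ok', hok', rfl, ?_⟩
      rw [hiff', hiff]
      refine ⟨fun h j' h1 h2 => ?_, fun h => ⟨fun j' h1 h2 => h j' (by omega) h2,
        fun s'' _ => h j le_rfl hj s''⟩⟩
      rcases Nat.eq_or_lt_of_le h1 with rfl | h3
      · exact fun s'' => h.2 s'' (Nat.zero_le _)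
      · exact h.1 j' h3 h2
  · rintro l μ' ⟨rfl, ok, hok, rfl, hiff⟩
    have hk : y.B + i < y.width := by rw [width_eq]; omega
    -- The double truncated subtraction maps every nonzero number to `1`, so the cell becomes the
    -- disjunction of its old content and the flag.
    refine .store_list (y.addr t s (y.B + i)) (1 - (1 - (μ' (y.addr t s (y.B + i)) + ok))) rfl rfl
      (by omega) ⟨ok, _, rfl, ?_⟩
    refine hμ.update hs hk (by omega) ?_ ?_
    · have h1 := hμ.ne_zero_iff t s hs _ hk
      rw [← h1]
      simp only [Nat.zero_le, true_implies] at hiff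
      simp only [true_and, ← hiff]
      omega
    · intro t' s' k' _ _ hne
      refine ⟨Or.inl, fun h => h.resolve_right ?_⟩
      rintro ⟨h1, h2, h3, -⟩
      exact hne ⟨h1, h2, h3⟩

/-- The cells of the table that belong to the time `t` and a state `≥ s`, or to a later time. -/
def From (y : Layout) (t s t' s' k : ℕ) : Prop :=
  (t < t' ∨ t' = t ∧ s ≤ s') ∧ t' ≤ y.T ∧ y.E t' s' k

/-- The condition on a sum that is ensured by the action `a`. -/
def Ensured (y : Layout) (t s a k : ℕ) : Prop :=
  y.B ≤ k ∧ k ≤ y.B + 2 * (y.T * y.B) ∧ ∀ j < y.m, ∀ s' < y.n, y.Ok t s a k j s'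

theorem E_iff {t s k : ℕ} (ht : t < y.T) (hs : s < y.n) (hk : k < y.width) :
    y.E t s k ↔ ∃ a < y.inp (3 + s), y.Ensured t s a k :=
  y.E_lt t ht s hs k (Nat.le_of_lt_succ hk)

/-- As all loops count down, the pointer in register `7` walks backwards through the tables from the
end of the input. On entry it stands one row beyond the row of `a`, and it is moved back before that
row is read. -/
theorem reaches_processAction (hb : y.width + y.len + 2 ≤ b) {t s a ok res : ℕ} (ht : t < y.T)
    (hs : s < y.n) (ha : a < y.inp (3 + s)) (hμ : y.Holds μ F)
    (hF : ∀ s < y.n, ∀ k < y.width, F (t + 1) s k ↔ y.E (t + 1) s k) :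
    Reaches b b processAction (listState (y.regs (y.pos t s (a + 1)) t s a 0 0 0 ok res) μ)
      fun st => ∃ ok' μ', st = listState (y.regs (y.pos t s a) t s a 0 0 0 ok' res) μ' ∧
        y.Holds μ' fun t' s' k' => F t' s' k' ∨ t' = t ∧ s' = s ∧ y.Ensured t s a k' := by
  have hpos := y.pos_action t ht s hs a ha
  have hle := y.pos_le t ht s hs a ha
  have hw := y.width_eq
  refine .seq (.assign_list (y.pos t s a) (by simp [regs]) ?_ (by omega) ?_)
  · change y.pos t s (a + 1) - 3 * (y.n + y.m) = _
    omega
  refine .forDown_list (b := b) (2 * (y.T * y.B) + 1) (fun q l μ' => ∃ ok,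
    l = y.regs (y.pos t s a) t s a q 0 0 ok res ∧ y.Holds μ' fun t' s' k' => F t' s' k' ∨
      t' = t ∧ s' = s ∧ y.B + q ≤ k' ∧ y.Ensured t s a k')
    (by simp [regs]) rfl (by omega) ⟨ok, rfl, hμ.congr ?_⟩ ?_ ?_ ?_
  · intro t' s' _ k' _
    refine ⟨Or.inl, fun h => h.resolve_right ?_⟩
    rintro ⟨-, -, h1, -, h2, -⟩
    omega
  · rintro q l μ' ⟨ok, rfl, -⟩
    exact ⟨by simp [regs], rfl⟩
  · rintro i hi l μ' ⟨ok, rfl, h⟩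
    refine (reaches_updateCell hb h ht hs ha ?_ (by omega)).mono ?_
    · intro s' hs' k hk
      rw [← hF s' hs' k hk]
      refine ⟨fun h => h.resolve_right ?_, Or.inl⟩
      rintro ⟨h, -⟩
      omega
    · rintro _ ⟨ok', μ', rfl, h'⟩
      refine ⟨_, _, rfl, ok', rfl, h'.congr fun t' s' _ k' _ => ?_⟩
      rw [or_assoc]
      refine or_congr_right ?_
      constructor
      · rintro (⟨h1, h2, h3, h4⟩ | ⟨h1, h2, h3, h4⟩)
        · exact ⟨h1, h2, by omega, h4⟩
        · subst h3
          exact ⟨h1, h2, le_rfl, by omega, by omega, h4⟩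
      · rintro ⟨h1, h2, h3, h4⟩
        rcases Nat.eq_or_lt_of_le h3 with rfl | h5
        · exact Or.inr ⟨h1, h2, rfl, h4.2.2⟩
        · exact Or.inl ⟨h1, h2, h5, h4⟩
  · rintro l μ' ⟨ok, rfl, h⟩
    refine ⟨ok, μ', rfl, h.congr fun t' s' _ k' _ => or_congr_right ?_⟩
    refine ⟨fun ⟨h1, h2, _, h3⟩ => ⟨h1, h2, h3⟩, fun ⟨h1, h2, h3⟩ => ⟨h1, h2, h3.1, h3⟩⟩

/-- The descending order of times is the backward recursion itself. Within a time, the part done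
consists of the states `≥ s`, and within a state of the actions `≥ a`; a cell is set as soon as one
processed action ensures its sum. -/
theorem reaches_fillTable (hb : y.width + y.len + 2 ≤ b)
    (hμ : y.Holds μ fun t _ k => t = y.T ∧ k = (y.T + 1) * y.B) :
    Reaches b b fillTable (listState (y.regs y.len 0 0 0 0 0 0 0 0) μ) fun st =>
      ∃ ptr ok μ', st = listState (y.regs ptr 0 0 0 0 0 0 ok 0) μ' ∧
        y.Holds μ' fun t s k => t ≤ y.T ∧ y.E t s k := by
  have hn := y.n_le
  have hT := y.T_le
  have hlen := y.le_len
  refine .forDown_list (b := b) y.T (fun q l μ' => ∃ ok,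
    l = y.regs (y.pos q 0 0) q 0 0 0 0 0 ok 0 ∧ y.Holds μ' (y.From q 0))
    (by simp [regs]) rfl (by omega) ⟨0, by rw [y.pos_T]; rfl, hμ.congr ?_⟩ ?_ ?_ ?_
  · intro t s hs k hk
    constructor
    · rintro ⟨rfl, rfl⟩
      exact ⟨by omega, le_rfl, (y.E_T s hs _ (Nat.le_of_lt_succ hk)).2 rfl⟩
    · rintro ⟨h1, h2, h3⟩
      obtain rfl : t = y.T := by omega
      exact ⟨rfl, (y.E_T s hs _ (Nat.le_of_lt_succ hk)).1 h3⟩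
  · rintro q l μ' ⟨ok, rfl, -⟩
    exact ⟨by simp [regs], rfl⟩
  · rintro t ht l μ₁ ⟨ok, rfl, h⟩
    refine .forDown_list (b := b) y.n (fun q l μ' => ∃ ok,
      l = y.regs (y.pos t q 0) t q 0 0 0 0 ok 0 ∧ y.Holds μ' (y.From t q))
      (by simp [regs]) rfl (by omega) ⟨ok, by rw [y.pos_time t ht]; rfl, h.congr ?_⟩ ?_ ?_ ?_
    · intro t' s' hs' k' hk'
      refine and_congr_left fun _ => ?_
      omega
    · rintro q l μ' ⟨ok, rfl, -⟩
      exact ⟨by simp [regs], rfl⟩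
    · rintro s hs l μ₂ ⟨ok, rfl, h⟩
      have ha := y.actions_le s hs
      refine .forDown_list (b := b) (y.inp (3 + s)) (fun q l μ' => ∃ ok,
        l = y.regs (y.pos t s q) t s q 0 0 0 ok 0 ∧ y.Holds μ' fun t' s' k' =>
          y.From t (s + 1) t' s' k' ∨ t' = t ∧ s' = s ∧ ∃ a < y.inp (3 + s), q ≤ a ∧
            y.Ensured t s a k')
        (by simp [regs]) (h.input (3 + s) (by omega)) (by omega)
        ⟨ok, by rw [y.pos_state t ht s hs]; rfl, h.congr ?_⟩ ?_ ?_ ?_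
      · intro t' s' hs' k' hk'
        refine ⟨Or.inl, fun h => h.resolve_right ?_⟩
        rintro ⟨-, -, a, h1, h2, -⟩
        omega
      · rintro q l μ' ⟨ok, rfl, -⟩
        exact ⟨by simp [regs], rfl⟩
      · rintro a ha l μ₃ ⟨ok, rfl, h⟩
        refine (reaches_processAction hb ht hs ha h ?_).mono ?_
        · intro s' hs' k hk
          constructor
          · rintro (h | ⟨h, -⟩)
            · exact h.2.2
            · omega
          · exact fun h => Or.inl ⟨by omega, ht, h⟩
        · rintro _ ⟨ok', μ', rfl, h'⟩
          refine ⟨_, _, rfl, ok', rfl, h'.congr fun t' s' _ k' _ => ?_⟩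
          rw [or_assoc]
          refine or_congr_right ?_
          constructor
          · rintro (⟨h1, h2, a', h3, h4, h5⟩ | ⟨h1, h2, h3⟩)
            · exact ⟨h1, h2, a', h3, by omega, h5⟩
            · exact ⟨h1, h2, a, ha, le_rfl, h3⟩
          · rintro ⟨h1, h2, a', h3, h4, h5⟩
            rcases Nat.eq_or_lt_of_le h4 with rfl | h6
            · exact Or.inr ⟨h1, h2, h5⟩
            · exact Or.inl ⟨h1, h2, a', h3, h6, h5⟩
      · rintro l μ' ⟨ok, rfl, h⟩
        refine ⟨_, _, rfl, ok, rfl, h.congr fun t' s' hs' k' hk' => ?_⟩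
        constructor
        · rintro (⟨h1, h2⟩ | ⟨rfl, rfl, a, h1, -, h2⟩)
          · exact ⟨by omega, h2⟩
          · exact ⟨by omega, ht.le, (E_iff ht hs hk').2 ⟨a, h1, h2⟩⟩
        · rintro ⟨h1, h2, h3⟩
          by_cases h4 : t' = t ∧ s' = s
          · obtain ⟨rfl, rfl⟩ := h4
            obtain ⟨a, h5, h6⟩ := (E_iff ht hs hk').1 h3
            exact Or.inr ⟨rfl, rfl, a, h5, Nat.zero_le _, h6⟩
          · exact Or.inl ⟨by omega, h2, h3⟩
    · rintro l μ' ⟨ok, rfl, h⟩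
      exact ⟨_, _, rfl, ok, rfl, h⟩
  · rintro l μ' ⟨ok, rfl, h⟩
    refine ⟨_, ok, μ', rfl, h.congr fun t' s' _ k' _ => ?_⟩
    refine ⟨fun h => h.2, fun h => ⟨by omega, h⟩⟩

theorem reaches_initTable (hb : y.width + y.len + 2 ≤ b) (hμ : y.Holds μ fun _ _ _ => False) :
    Reaches b b initTable (listState (y.regs y.len 0 0 0 0 0 0 0 0) μ) fun st =>
      ∃ μ', st = listState (y.regs y.len 0 0 0 0 0 0 0 0) μ' ∧
        y.Holds μ' fun t _ k => t = y.T ∧ k = (y.T + 1) * y.B := by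
  have hn := y.n_le
  refine .forDown_list (b := b) y.n (fun q l μ' => l = y.regs y.len 0 q 0 0 0 0 0 0 ∧
    y.Holds μ' fun t s k => t = y.T ∧ q ≤ s ∧ k = (y.T + 1) * y.B)
    (by simp [regs]) rfl (by omega) ⟨rfl, hμ.congr ?_⟩ ?_ ?_ ?_
  · intro t s hs k hk
    exact ⟨False.elim, fun h => by omega⟩
  · rintro q l μ' ⟨rfl, -⟩
    exact ⟨by simp [regs], rfl⟩
  · rintro s hs l μ' ⟨rfl, h⟩
    refine .store_list (y.addr y.T s ((y.T + 1) * y.B)) 1 rfl rfl (by omega) ⟨_, _, rfl, rfl, ?_⟩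
    refine h.update hs (by unfold width; omega) le_rfl (by simp) ?_
    intro t' s' k' _ _ hne
    constructor
    · rintro ⟨h1, h2, h3⟩; exact ⟨h1, by omega, h3⟩
    · rintro ⟨h1, h2, h3⟩
      refine ⟨h1, ?_, h3⟩
      by_contra h4
      exact hne ⟨h1, by omega, h3⟩
  · rintro l μ' ⟨rfl, h⟩
    refine ⟨μ', rfl, h.congr fun t s _ k _ => ?_⟩
    simp

/-- The scan accumulates a disjunction over all sums in the admissible range. Register `0` is the
base address of the table until then, so the answer is moved there only at the very end. -/
theorem reaches_readAnswer (hb : y.width + y.len + 2 ≤ b) {ptr ok : ℕ}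
    (hμ : y.Holds μ fun t s k => t ≤ y.T ∧ y.E t s k) :
    Reaches b b readAnswer (listState (y.regs ptr 0 0 0 0 0 0 ok 0) μ) fun st =>
      st.reg 0 ≤ 1 ∧ (st.reg 0 ≠ 0 ↔
        ∃ k, y.B ≤ k ∧ k ≤ y.B + 2 * (y.T * y.B) ∧ y.E 0 (y.inp 2) k) := by
  have hw := y.width_eq
  have hlen := y.le_len
  have hinit := y.init_lt
  refine .seq (.forDown_list (b := b) (2 * (y.T * y.B) + 1) (fun q l μ' => μ' = μ ∧ ∃ res ≤ 1,
    l = y.regs ptr 0 0 0 q 0 0 ok res ∧ (res ≠ 0 ↔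
      ∃ k, y.B + q ≤ k ∧ k ≤ y.B + 2 * (y.T * y.B) ∧ y.E 0 (y.inp 2) k))
    (by simp [regs]) rfl (by omega) ⟨rfl, 0, by omega, rfl, ?_⟩ ?_ ?_ ?_)
  · refine ⟨fun h => absurd rfl h, ?_⟩
    rintro ⟨k, h1, h2, -⟩
    omega
  · rintro q l μ' ⟨-, res, -, rfl, -⟩
    exact ⟨by simp [regs], rfl⟩
  · rintro i hi l μ' ⟨rfl, res, hres, rfl, hiff⟩
    have hk : y.B + i < y.width := by omega
    have h1 := hμ.ne_zero_iff 0 _ hinit _ hk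
    refine .assign_list (1 - (1 - (res + μ' (y.addr 0 (y.inp 2) (y.B + i))))) (by simp [regs])
      ?_ (by omega) ⟨_, _, rfl, rfl, _, Nat.sub_le _ _, rfl, ?_⟩
    · rw [← hμ.input 2 (by omega)]
      rfl
    · have h2 : 1 - (1 - (res + μ' (y.addr 0 (y.inp 2) (y.B + i)))) ≠ 0 ↔
          res ≠ 0 ∨ μ' (y.addr 0 (y.inp 2) (y.B + i)) ≠ 0 := by omega
      rw [h2, hiff, h1]
      constructor
      · rintro (⟨k, h3, h4, h5⟩ | ⟨-, h3⟩)
        · exact ⟨k, by omega, h4, h5⟩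
        · exact ⟨_, le_rfl, by omega, h3⟩
      · rintro ⟨k, h3, h4, h5⟩
        rcases Nat.eq_or_lt_of_le h3 with rfl | h6
        · exact Or.inr ⟨Nat.zero_le _, h5⟩
        · exact Or.inl ⟨k, h6, h4, h5⟩
  · rintro l μ' ⟨rfl, res, hres, rfl, hiff⟩
    exact .assign_list res (by simp [regs]) rfl (by omega) ⟨hres, hiff⟩

theorem reaches_readParameters (hb : y.width + y.len + 2 ≤ b) (hμ : ∀ i < y.len, μ i = y.inp i) :
    Reaches b b readParameters (listState [y.len, 0, 0, 0, 0, 0, 0, 0, 0, 0, 0, 0, 0, 0, 0, 0] μ)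
      fun st => st = listState (y.regs y.len 0 0 0 0 0 0 0 0) μ := by
  have hw := y.width_eq
  have hlen := y.le_len
  have hT := y.T_le
  refine .seq (.assign_list y.T (by simp) ((hμ 0 (by omega)).trans y.inp_zero) (by omega) ?_)
  refine .seq (.assign_list y.n (by simp) ((hμ 1 (by omega)).trans y.inp_one) (by omega) ?_)
  refine .seq (.assign_list y.m (by simp) ((hμ (3 + y.n) (by omega)).trans y.inp_m) (by omega) ?_)
  refine .seq (.assign_list (3 * (y.n + y.m)) (by simp) rfl (by have := y.row_le; omega) ?_)
  refine .seq (.assign_list y.len (by simp) rfl (by omega) (.seq ?_))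
  -- The indices from `q` on have been added to `B`, the sum over `range q` is still missing.
  refine .forDown_list (b := b) y.m (fun q l μ' => μ' = μ ∧ ∃ B, l = [y.len, y.T, y.n, y.m,
    3 * (y.n + y.m), B, 0, y.len, 0, 0, 0, 0, q, 0, 0, 0] ∧
      B + ∑ j ∈ Finset.range q, y.inp (4 + y.n + 3 * j + 1) = y.B)
    (by simp) rfl (by omega) ⟨rfl, 0, rfl, by rw [zero_add]; exact y.sum_mag⟩ ?_ ?_ ?_
  · rintro q l μ' ⟨-, B, rfl, -⟩
    exact ⟨by simp, rfl⟩
  · rintro j hj l μ' ⟨rfl, B, rfl, h⟩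
    rw [Finset.sum_range_succ] at h
    refine .assign_list (B + y.inp (4 + y.n + 3 * j + 1)) (by simp) ?_ (by omega)
      ⟨_, _, rfl, rfl, _, rfl, by omega⟩
    rw [← hμ (4 + y.n + 3 * j + 1) (by omega)]
    rfl
  · rintro l μ' ⟨rfl, B, rfl, h⟩
    obtain rfl : B = y.B := by simpa using h
    exact .assign_list y.width (by simp) rfl (by omega) rfl

theorem reaches_decideZeroVariance (hb : y.width + y.len + 2 ≤ b) (hμ : ∀ i < y.len, μ i = y.inp i)
    (hμ' : ∀ i, y.len ≤ i → μ i = 0) :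
    Reaches b b decideZeroVariance
      (listState [y.len, 0, 0, 0, 0, 0, 0, 0, 0, 0, 0, 0, 0, 0, 0, 0] μ) fun st =>
        st.reg 0 ≤ 1 ∧ (st.reg 0 ≠ 0 ↔
          ∃ k, y.B ≤ k ∧ k ≤ y.B + 2 * (y.T * y.B) ∧ y.E 0 (y.inp 2) k) := by
  -- Memory beyond the input is zero, so it already is the table of the empty predicate.
  have h0 : y.Holds μ fun _ _ _ => False := by
    have h : ∀ t s k, μ (y.addr t s k) = 0 := fun t s k => hμ' _ (by simp only [addr]; omega)
    exact ⟨hμ, fun t s _ k _ => by simp [h], fun t s _ k _ => by simp [h]⟩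
  refine .seq ((reaches_readParameters hb hμ).mono ?_)
  rintro _ rfl
  refine .seq ((reaches_initTable hb h0).mono ?_)
  rintro _ ⟨μ', rfl, h'⟩
  refine .seq ((reaches_fillTable hb h').mono ?_)
  rintro _ ⟨ptr, ok, μ'', rfl, h''⟩
  exact reaches_readAnswer hb h''

end Layout

/-! ### The encoding of an instance -/

/-- The list `l'` occurs in `l`, starting at position `p`. -/
def OccursAt (l : List ℕ) (p : ℕ) (l' : List ℕ) : Prop :=
  ∃ u v, l = u ++ l' ++ v ∧ u.length = p

namespace OccursAt

variable {l l' l'' : List ℕ} {p q : ℕ}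

theorem trans (h : OccursAt l p l') (h' : OccursAt l' q l'') : OccursAt l (p + q) l'' := by
  obtain ⟨u, v, rfl, rfl⟩ := h
  obtain ⟨u', v', rfl, rfl⟩ := h'
  exact ⟨u ++ u', v' ++ v, by simp, by simp⟩

theorem append_left (l l' : List ℕ) : OccursAt (l ++ l') 0 l := ⟨[], l', by simp, rfl⟩

theorem append_right (l l' : List ℕ) : OccursAt (l ++ l') l.length l' := ⟨l, [], by simp, rfl⟩

theorem add_length_le (h : OccursAt l p l') : p + l'.length ≤ l.length := by
  obtain ⟨u, v, rfl, rfl⟩ := h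
  simp

theorem getD_add (h : OccursAt l p l') {j : ℕ} (hj : j < l'.length) :
    l.getD (p + j) 0 = l'.getD j 0 := by
  obtain ⟨u, v, rfl, rfl⟩ := h
  simp [List.getD, List.getElem?_append, hj]

end OccursAt

/-- The position of a block in a concatenation, where `g` gives the partial sums of the lengths. -/
theorem flatMap_finRange_occursAt {n : ℕ} (f : Fin n → List ℕ) (g : ℕ → ℕ) (h0 : g 0 = 0)
    (hg : ∀ i : Fin n, g (i + 1) = g i + (f i).length) :
    ((List.finRange n).flatMap f).length = g n ∧
      ∀ i : Fin n, OccursAt ((List.finRange n).flatMap f) (g i) (f i) := by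
  induction n generalizing g with
  | zero => exact ⟨by simp [h0], fun i => i.elim0⟩
  | succ n ih =>
    have h1 := hg 0
    simp only [Fin.val_zero, zero_add, h0] at h1
    -- Dropping the first block shifts all partial sums by `g 1`; the truncated difference is exact
    -- because `g` is monotone.
    obtain ⟨h2, h3⟩ := ih (fun i => f i.succ) (fun i => g (i + 1) - g 1) (by simp) fun i => by
      have h : ∀ i : Fin (n + 1), g 1 ≤ g (i + 1) := by
        intro i
        induction i using Fin.induction with
        | zero => simp
        | succ i ih =>
          rw [hg i.succ]
          exact ih.trans (Nat.le_add_right _ _)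
      have h4 := hg i.succ
      have h5 := h i.castSucc
      simp only [Fin.val_succ, Fin.val_castSucc] at h4 h5 ⊢
      omega
    have hmono : ∀ i ≤ n, g 1 ≤ g (i + 1) := by
      intro i
      induction i with
      | zero => simp
      | succ i ih =>
        intro hi
        have := hg ⟨i + 1, by omega⟩
        exact (ih (by omega)).trans (by simp only at this; omega)
    rw [List.finRange_succ, List.flatMap_cons, List.flatMap_map]
    refine ⟨?_, fun i => ?_⟩
    · rw [List.length_append, h2]
      have := hmono n le_rfl
      omega
    · cases i using Fin.cases with
      | zero => rw [Fin.val_zero, h0]; exact .append_left _ _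
      | succ i =>
        have := (OccursAt.append_right (f 0) _).trans (h3 i)
        have h4 := hmono i (by omega)
        rw [Fin.val_succ]
        convert this using 1
        omega

theorem flatMap_finRange_occursAt_mul {n : ℕ} (f : Fin n → List ℕ) (c : ℕ)
    (hf : ∀ i, (f i).length = c) :
    ((List.finRange n).flatMap f).length = n * c ∧
      ∀ i : Fin n, OccursAt ((List.finRange n).flatMap f) (i * c) (f i) :=
  flatMap_finRange_occursAt f (· * c) (by simp) fun i => by rw [hf]; ring

theorem logCost_getD_le (l : List ℕ) (i : ℕ) : logCost (l.getD i 0) ≤ inputSize l + 1 := by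
  by_cases h : i < l.length
  · have : logCost (l.getD i 0) ∈ l.map logCost :=
      List.mem_map_of_mem (by rw [List.getD_eq_getElem _ _ h]; exact List.getElem_mem h)
    exact (List.single_le_sum (fun _ _ => Nat.zero_le _) _ this).trans (Nat.le_succ _)
  · simp [List.getD, not_lt.1 h, logCost]

theorem length_le_inputSize (l : List ℕ) : l.length ≤ inputSize l := by
  induction l with
  | nil => simp
  | cons a l ih =>
    simp only [inputSize, List.map_cons, List.sum_cons, List.length_cons, logCost] at ih ⊢
    omega

/-! ### Addresses of the data, size bounds, and the resulting layout -/

namespace IntegerMDP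

variable (x : IntegerMDP)

/-- The `j`-th reward, in increasing order. -/
def reward (j : Fin x.mdp.R.card) : x.mdp.R := x.mdp.R.orderIsoOfFin rfl j

theorem reward_surjective : Function.Surjective x.reward :=
  (x.mdp.R.orderIsoOfFin rfl).surjective

theorem rewardList_flatMap (f : x.mdp.R → List ℕ) :
    x.rewardList.flatMap f = (List.finRange x.mdp.R.card).flatMap fun j => f (x.reward j) := by
  rw [rewardList, List.flatMap_map]
  rfl

/-- The number of actions available at the states before `s`. -/
def actionsBefore (s : ℕ) : ℕ := ∑ i ∈ Finset.range s, (List.ofFn x.numActions).getD i 0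

theorem getD_numActions (s : Fin x.numStates) :
    (List.ofFn x.numActions).getD s 0 = x.numActions s := by
  simp [List.getD]

theorem actionsBefore_succ (s : Fin x.numStates) :
    x.actionsBefore (s + 1) = x.actionsBefore s + x.numActions s := by
  rw [actionsBefore, Finset.sum_range_succ, getD_numActions, actionsBefore]

theorem actionsBefore_mono {s s' : ℕ} (h : s ≤ s') : x.actionsBefore s ≤ x.actionsBefore s' :=
  Finset.sum_le_sum_of_subset (Finset.range_mono h)

/-- The length of the tables for one time, state and action. -/
def rowLength : ℕ := 3 * (x.numStates + x.mdp.R.card)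

/-- The position of the tables for the time `t`, the state `s` and the action `a`. -/
def rowPos (t s a : ℕ) : ℕ :=
  4 + x.numStates + 3 * x.mdp.R.card + t * (x.actionsBefore x.numStates * x.rowLength) +
    x.actionsBefore s * x.rowLength + a * x.rowLength

/-- The tables for one time, state and action. -/
def row (t : Fin x.mdp.T) (s : Fin x.numStates) (a : Fin (x.numActions s)) : List ℕ :=
  ((List.finRange x.numStates).flatMap fun s' => encodeRat (x.mdp.p t s a s')) ++
    (List.finRange x.mdp.R.card).flatMap fun j => encodeRat (x.mdp.g t s a (x.reward j))

theorem length_encodeRat (q : ℚ) : (encodeRat q).length = 3 := rfl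

theorem length_row (t : Fin x.mdp.T) (s : Fin x.numStates) (a : Fin (x.numActions s)) :
    (x.row t s a).length = x.rowLength := by
  rw [row, List.length_append, (flatMap_finRange_occursAt_mul _ 3 fun _ => rfl).1,
    (flatMap_finRange_occursAt_mul _ 3 fun _ => rfl).1, rowLength]
  ring

/-- The tables of `p` and `g`. -/
def table : List ℕ :=
  (List.finRange x.mdp.T).flatMap fun t => (List.finRange x.numStates).flatMap fun s =>
    (List.finRange (x.numActions s)).flatMap fun a => x.row t s a

/-- The encodings of the rewards. -/
def encodedRewards : List ℕ :=
  (List.finRange x.mdp.R.card).flatMap fun j => encodeRat (x.reward j)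

theorem encode_eq : x.encode = [x.mdp.T, x.numStates, (x.mdp.init : ℕ)] ++
    (List.ofFn x.numActions ++ ([x.mdp.R.card] ++ (x.encodedRewards ++ x.table))) := by
  simp only [encode, List.bind_eq_flatMap, List.pure_def, List.flatMap_assoc, List.flatMap_cons,
    List.flatMap_nil, List.append_nil, rewardList_flatMap, table, encodedRewards, row,
    List.append_assoc]

theorem table_occursAt :
    x.table.length = x.mdp.T * (x.actionsBefore x.numStates * x.rowLength) ∧
      ∀ (t : Fin x.mdp.T) (s : Fin x.numStates) (a : Fin (x.numActions s)), OccursAt x.table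
        (t * (x.actionsBefore x.numStates * x.rowLength) + x.actionsBefore s * x.rowLength +
          a * x.rowLength) (x.row t s a) := by
  have h1 := fun t s => flatMap_finRange_occursAt_mul (x.row t s) _ (x.length_row t s)
  have h2 := fun t => flatMap_finRange_occursAt
    (fun s => (List.finRange (x.numActions s)).flatMap fun a => x.row t s a)
    (fun s => x.actionsBefore s * x.rowLength) (by simp [actionsBefore]) fun s => by
      rw [(h1 t s).1, actionsBefore_succ, add_mul]
  have h3 := flatMap_finRange_occursAt_mul (fun t => (List.finRange x.numStates).flatMap fun s =>
    (List.finRange (x.numActions s)).flatMap fun a => x.row t s a) _ fun t => (h2 t).1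
  exact ⟨h3.1, fun t s a => ((h3.2 t).trans ((h2 t).2 s)).trans ((h1 t s).2 a)⟩

theorem length_encodedRewards : x.encodedRewards.length = x.mdp.R.card * 3 :=
  (flatMap_finRange_occursAt_mul _ 3 fun _ => rfl).1

theorem length_encode : x.encode.length = x.rowPos x.mdp.T 0 0 := by
  rw [encode_eq]
  simp only [List.length_append, List.length_ofFn, length_encodedRewards, x.table_occursAt.1,
    rowPos, show x.actionsBefore 0 = 0 from rfl, List.length_cons, List.length_nil]
  ring

theorem actions_occursAt : OccursAt x.encode 3 (List.ofFn x.numActions) := by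
  rw [encode_eq]
  exact (OccursAt.append_right _ _).trans (.append_left _ _)

theorem rewards_occursAt : OccursAt x.encode (3 + x.numStates) ([x.mdp.R.card] ++
    (x.encodedRewards ++ x.table)) := by
  have h := OccursAt.append_right (List.ofFn x.numActions) ([x.mdp.R.card] ++
    (x.encodedRewards ++ x.table))
  rw [List.length_ofFn] at h
  rw [encode_eq]
  exact (OccursAt.append_right [_, _, _] _).trans h

theorem reward_occursAt (j : Fin x.mdp.R.card) :
    OccursAt x.encode (4 + x.numStates + 3 * j) (encodeRat (x.reward j)) := by
  have h := (x.rewards_occursAt.trans (.append_right _ _)).trans ((OccursAt.append_left _ _).trans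
    ((flatMap_finRange_occursAt_mul (fun j => encodeRat (x.reward j)) 3 fun _ => rfl).2 j))
  convert h using 1
  simp only [List.length_cons, List.length_nil]
  ring

theorem row_occursAt (t : Fin x.mdp.T) (s : Fin x.numStates) (a : Fin (x.numActions s)) :
    OccursAt x.encode (x.rowPos t s a) (x.row t s a) := by
  have h := ((x.rewards_occursAt.trans (.append_right _ _)).trans (.append_right _ _)).trans
    (x.table_occursAt.2 t s a)
  convert h using 1
  simp only [List.length_cons, List.length_nil, length_encodedRewards, rowPos]
  ring

theorem getD_p (t : Fin x.mdp.T) (s : Fin x.numStates) (a : Fin (x.numActions s))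
    (s' : Fin x.numStates) :
    x.encode.getD (x.rowPos t s a + 3 * s' + 1) 0 = (x.mdp.p t s a s').num.natAbs := by
  have h := (x.row_occursAt t s a).trans ((OccursAt.append_left _ _).trans
    ((flatMap_finRange_occursAt_mul (fun s' => encodeRat (x.mdp.p t s a s')) 3
      fun _ => rfl).2 s'))
  have h' := h.getD_add (j := 1) (by simp [length_encodeRat])
  refine Eq.trans ?_ h'
  congr 1
  ring

theorem getD_g (t : Fin x.mdp.T) (s : Fin x.numStates) (a : Fin (x.numActions s))
    (j : Fin x.mdp.R.card) :
    x.encode.getD (x.rowPos t s a + 3 * x.numStates + 3 * j + 1) 0 =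
      (x.mdp.g t s a (x.reward j)).num.natAbs := by
  have h := (x.row_occursAt t s a).trans ((OccursAt.append_right _ _).trans
    ((flatMap_finRange_occursAt_mul (fun j => encodeRat (x.mdp.g t s a (x.reward j))) 3
      fun _ => rfl).2 j))
  have h' := h.getD_add (j := 1) (by simp [length_encodeRat])
  rw [(flatMap_finRange_occursAt_mul _ 3 fun _ => rfl).1] at h'
  refine Eq.trans ?_ h'
  congr 1
  ring

theorem getD_sign (j : Fin x.mdp.R.card) : x.encode.getD (4 + x.numStates + 3 * j) 0 =
    if (x.reward j : ℚ) < 0 then 1 else 0 :=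
  (x.reward_occursAt j).getD_add (j := 0) (by simp [length_encodeRat])

theorem getD_magnitude (j : Fin x.mdp.R.card) :
    x.encode.getD (4 + x.numStates + 3 * j + 1) 0 = (x.reward j : ℚ).num.natAbs :=
  (x.reward_occursAt j).getD_add (j := 1) (by simp [length_encodeRat])

theorem getD_actions (s : Fin x.numStates) : x.encode.getD (3 + s) 0 = x.numActions s :=
  (x.actions_occursAt.getD_add (by simp)).trans (x.getD_numActions s)

/-- A bound on the absolute values of the rewards. -/
def rewardSum : ℕ :=
  ∑ j ∈ Finset.range x.mdp.R.card, x.encode.getD (4 + x.numStates + 3 * j + 1) 0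

theorem natAbs_reward_le (j : Fin x.mdp.R.card) : (x.reward j : ℚ).num.natAbs ≤ x.rewardSum := by
  rw [← getD_magnitude]
  exact Finset.single_le_sum (f := fun j => x.encode.getD (4 + x.numStates + 3 * j + 1) 0)
    (fun _ _ => Nat.zero_le _) (Finset.mem_range.2 j.2)

theorem num_reward (j : Fin x.mdp.R.card) : ((x.reward j : ℚ).num : ℚ) = x.reward j := by
  obtain ⟨z, hz⟩ := x.integer_rewards _ (x.reward j).2
  rw [hz]
  simp

theorem natAbs_reward_le_K (j : Fin x.mdp.R.card) : (x.reward j : ℚ).num.natAbs ≤ x.K := by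
  have h : (x.reward j : ℚ).num.natAbs = ⌈|(x.reward j : ℚ)|⌉₊ := by
    rw [← x.num_reward j, Rat.num_intCast, ← Int.cast_abs, Int.abs_eq_natAbs, Int.cast_natCast,
      Nat.ceil_natCast]
  rw [h]
  exact Finset.le_sup (f := fun r : ℚ => ⌈|r|⌉₊) (x.reward j).2

/-- The sum of the magnitudes is used in place of their maximum because it needs additions only; the
price is a factor bounded by the input length. -/
theorem rewardSum_le : x.rewardSum ≤ x.mdp.R.card * x.K := by
  refine (Finset.sum_le_card_nsmul _ _ x.K fun j hj => ?_).trans (by simp)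
  exact (x.getD_magnitude ⟨j, Finset.mem_range.1 hj⟩).trans_le (x.natAbs_reward_le_K _)

theorem exists_int_abs_le (r : ℚ) (hr : r ∈ x.mdp.R) :
    ∃ z : ℤ, r = z ∧ |z| ≤ (x.rewardSum : ℤ) := by
  obtain ⟨j, hj⟩ := x.reward_surjective ⟨r, hr⟩
  have h1 := x.num_reward j
  have h2 := x.natAbs_reward_le j
  rw [hj] at h1 h2
  exact ⟨r.num, h1.symm, by rw [Int.abs_eq_natAbs]; exact_mod_cast h2⟩

/-- From the state `s` at time `t`, a total reward of `k - (T + 1) * rewardSum` can be ensured. -/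
def EnsuresShifted (t s k : ℕ) : Prop :=
  ∃ h : s < x.numStates, x.mdp.Ensures t ⟨s, h⟩ ((k : ℚ) - (x.mdp.T + 1) * x.rewardSum)

theorem ensuresShifted_horizon {s k : ℕ} (hs : s < x.numStates) :
    x.EnsuresShifted x.mdp.T s k ↔ k = (x.mdp.T + 1) * x.rewardSum := by
  simp only [EnsuresShifted, hs, exists_true_left, MDP.ensures_horizon, sub_eq_zero]
  exact_mod_cast Iff.rfl

/-- The shift is by `(T + 1) * rewardSum` although ensured sums are at least `-T * rewardSum`: the
spare `rewardSum` keeps `k - r` nonnegative for every reward `r`. -/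
theorem bounds_of_ensures {t k : ℕ} (ht : t ≤ x.mdp.T) {s : Fin x.numStates}
    (h : x.mdp.Ensures t s ((k : ℚ) - (x.mdp.T + 1) * x.rewardSum)) :
    x.rewardSum ≤ k ∧ k ≤ x.rewardSum + 2 * (x.mdp.T * x.rewardSum) := by
  obtain ⟨z, hz, hb⟩ := h.exists_int x.exists_int_abs_le (d := x.mdp.T - t) (by omega)
  have h1 : (k : ℤ) - (x.mdp.T + 1) * x.rewardSum = z := by exact_mod_cast hz
  have h2 : (x.mdp.T - t : ℕ) * (x.rewardSum : ℤ) ≤ x.mdp.T * x.rewardSum := by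
    exact_mod_cast Nat.mul_le_mul_right _ (Nat.sub_le _ _)
  have h3 := abs_le.1 (hb.trans h2)
  rw [← h1] at h3
  zify
  constructor <;> linarith

theorem cast_index {k : ℕ} (hk : x.rewardSum ≤ k) (j : Fin x.mdp.R.card) :
    ((k + 2 * x.encode.getD (4 + x.numStates + 3 * j) 0 *
      x.encode.getD (4 + x.numStates + 3 * j + 1) 0 -
      x.encode.getD (4 + x.numStates + 3 * j + 1) 0 : ℕ) : ℚ) = k - x.reward j := by
  have h := x.natAbs_reward_le j
  rw [getD_sign, getD_magnitude, Nat.cast_sub (by omega), ← x.num_reward j, Rat.num_intCast]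
  push_cast
  rw [Nat.cast_natAbs]
  split_ifs with h0
  · rw [abs_of_neg (by exact_mod_cast h0)]
    push_cast
    ring
  · rw [abs_of_nonneg (by exact_mod_cast not_lt.1 h0)]
    ring

theorem ensuresShifted_of_lt {t s k : ℕ} (ht : t < x.mdp.T) (hs : s < x.numStates) :
    x.EnsuresShifted t s k ↔ ∃ a < x.encode.getD (3 + s) 0,
      x.rewardSum ≤ k ∧ k ≤ x.rewardSum + 2 * (x.mdp.T * x.rewardSum) ∧
      ∀ j < x.mdp.R.card, ∀ s' < x.numStates,
        x.encode.getD (x.rowPos t s a + 3 * x.numStates + 3 * j + 1) 0 ≠ 0 →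
        x.encode.getD (x.rowPos t s a + 3 * s' + 1) 0 ≠ 0 →
        x.EnsuresShifted (t + 1) s' (k + 2 * x.encode.getD (4 + x.numStates + 3 * j) 0 *
          x.encode.getD (4 + x.numStates + 3 * j + 1) 0 -
          x.encode.getD (4 + x.numStates + 3 * j + 1) 0) := by
  have hact := x.getD_actions ⟨s, hs⟩
  simp only at hact
  rw [hact]
  constructor
  · rintro ⟨_, h⟩
    obtain ⟨hk, hk'⟩ := x.bounds_of_ensures ht.le h
    obtain ⟨a, ha⟩ := (MDP.ensures_of_lt ht _ _).1 h
    refine ⟨a, a.2, hk, hk', fun j hj s' hs' hg hp => ⟨hs', ?_⟩⟩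
    rw [x.getD_g ⟨t, ht⟩ ⟨s, hs⟩ a ⟨j, hj⟩, Int.natAbs_ne_zero, Rat.num_ne_zero] at hg
    rw [x.getD_p ⟨t, ht⟩ ⟨s, hs⟩ a ⟨s', hs'⟩, Int.natAbs_ne_zero, Rat.num_ne_zero] at hp
    rw [x.cast_index hk ⟨j, hj⟩, sub_right_comm]
    exact ha _ hg _ hp
  · rintro ⟨a, ha, hk, -, h⟩
    refine ⟨hs, (MDP.ensures_of_lt ht _ _).2 ⟨⟨a, ha⟩, fun r hg s' hp => ?_⟩⟩
    obtain ⟨j, rfl⟩ := x.reward_surjective r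
    obtain ⟨_, h'⟩ := h j j.2 s' s'.2
      (by rwa [x.getD_g ⟨t, ht⟩ ⟨s, hs⟩ ⟨a, ha⟩ j, Int.natAbs_ne_zero, Rat.num_ne_zero])
      (by rwa [x.getD_p ⟨t, ht⟩ ⟨s, hs⟩ ⟨a, ha⟩ s', Int.natAbs_ne_zero, Rat.num_ne_zero])
    rwa [x.cast_index hk j, sub_right_comm] at h'

theorem exists_ensuresShifted_iff : (∃ π : x.mdp.Policy, x.mdp.V π = 0) ↔
    ∃ k, x.rewardSum ≤ k ∧ k ≤ x.rewardSum + 2 * (x.mdp.T * x.rewardSum) ∧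
      x.EnsuresShifted 0 x.mdp.init k := by
  rw [MDP.exists_V_eq_zero_iff]
  constructor
  · rintro ⟨c, hc⟩
    obtain ⟨z, rfl, hz⟩ := hc.exists_int x.exists_int_abs_le (d := x.mdp.T) (by simp)
    -- An ensured sum is an integer `z ≥ -T * rewardSum`, so its shift is a natural number.
    obtain ⟨k, hk⟩ := Int.eq_ofNat_of_zero_le (a := z + (x.mdp.T + 1) * x.rewardSum)
      (by have := abs_le.1 hz; linarith [Nat.zero_le x.rewardSum])
    have hk' : (z : ℚ) = k - (x.mdp.T + 1) * x.rewardSum := by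
      rw [eq_sub_iff_add_eq]
      exact_mod_cast hk
    rw [hk'] at hc
    obtain ⟨h1, h2⟩ := x.bounds_of_ensures (Nat.zero_le _) hc
    exact ⟨k, h1, h2, x.mdp.init.2, hc⟩
  · rintro ⟨k, -, -, h, hk⟩
    exact ⟨_, hk⟩

theorem rowPos_add_le (t : Fin x.mdp.T) (s : Fin x.numStates) (a : Fin (x.numActions s)) :
    x.rowPos t s a + x.rowLength ≤ x.encode.length := by
  have h := (x.row_occursAt t s a).add_length_le
  rwa [length_row] at h

theorem numActions_pos (s : Fin x.numStates) : 0 < x.numActions s :=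
  Fin.pos_iff_nonempty.2 (x.mdp.nonempty_actions s)

/-- The number is written in binary, but each action contributes a nonempty row to the input. One
applies the position bound to the last action, which has all the others before it. -/
theorem numActions_le (s : Fin x.numStates) : x.numActions s ≤ x.encode.length := by
  have h0 := x.numActions_pos s
  have h := x.rowPos_add_le ⟨0, x.mdp.T_pos⟩ s ⟨x.numActions s - 1, by omega⟩
  have hL : 1 ≤ x.rowLength := by
    have := s.pos
    unfold rowLength
    omega
  have h1 : (x.numActions s - 1) * 1 ≤ (x.numActions s - 1) * x.rowLength :=
    Nat.mul_le_mul_left _ hL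
  simp only [rowPos] at h
  omega

/-- Although `T` is written in binary, every time step contributes a nonempty table, since the
initial state has an action. Without this the table of the algorithm would not be of
pseudopolynomial size. -/
theorem horizon_le : x.mdp.T ≤ x.encode.length := by
  have h0 := x.numActions_pos x.mdp.init
  have hL : 1 ≤ x.actionsBefore x.numStates * x.rowLength := by
    refine Nat.mul_pos ?_ ?_
    · have h1 := x.actionsBefore_mono (Nat.succ_le_of_lt x.mdp.init.2)
      rw [Nat.succ_eq_add_one, actionsBefore_succ] at h1
      omega
    · have := x.mdp.init.pos
      unfold rowLength
      omega
  have h1 := Nat.mul_le_mul_left x.mdp.T hL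
  rw [length_encode, rowPos]
  omega

/-- The layout of an instance in the memory. -/
def layout : Layout where
  inp i := x.encode.getD i 0
  len := x.encode.length
  T := x.mdp.T
  n := x.numStates
  m := x.mdp.R.card
  B := x.rewardSum
  pos := x.rowPos
  E := x.EnsuresShifted
  inp_zero := rfl
  inp_one := rfl
  init_lt := x.mdp.init.2
  inp_m := x.rewards_occursAt.getD_add (j := 0) (by simp)
  le_len := by
    rw [length_encode, rowPos]
    omega
  row_le := le_of_add_le_right
    (x.rowPos_add_le ⟨0, x.mdp.T_pos⟩ x.mdp.init ⟨0, x.numActions_pos _⟩)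
  T_le := x.horizon_le
  actions_le s hs := (x.getD_actions ⟨s, hs⟩).trans_le (x.numActions_le _)
  sum_mag := rfl
  sgn_le j hj := by
    rw [x.getD_sign ⟨j, hj⟩]
    split_ifs <;> omega
  pos_T := x.length_encode.symm
  pos_time t _ := by
    simp only [rowPos, actionsBefore, Finset.range_zero, Finset.sum_empty]
    ring
  pos_state t _ s hs := by
    have h := x.actionsBefore_succ ⟨s, hs⟩
    have h' := x.getD_actions ⟨s, hs⟩
    simp only at h h'
    rw [h', rowPos, rowPos, h]
    ring
  pos_action t _ s _ a _ := by
    simp only [rowPos, rowLength]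
    ring
  pos_le t ht s hs a ha :=
    x.rowPos_add_le ⟨t, ht⟩ ⟨s, hs⟩ ⟨a, by rwa [x.getD_actions ⟨s, hs⟩] at ha⟩
  E_T s hs k _ := x.ensuresShifted_horizon hs
  E_lt t ht s hs k _ := x.ensuresShifted_of_lt ht hs

theorem ofInput_encode : RAMState.ofInput x.encode =
    listState [x.encode.length, 0, 0, 0, 0, 0, 0, 0, 0, 0, 0, 0, 0, 0, 0, 0]
      fun i => x.encode.getD i 0 := by
  rw [RAMState.ofInput, listState]
  congr 1
  funext i
  cases i with
  | zero => rfl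
  | succ i =>
    by_cases hi : i < 15
    · interval_cases i <;> rfl
    · simp [List.getD, not_lt.1 hi]

theorem pseudopolynomialTime :
    PseudopolynomialTime encode K fun x => ∃ π : x.mdp.Policy, x.mdp.V π = 0 := by
  obtain ⟨P, hP⟩ := Prog.decideZeroVariance.exists_polynomial_weight
  -- This dominates `width + len + 2` for `T ≤ X`, `rewardSum ≤ X * X` and `len ≤ X`. It bounds both
  -- the lengths of cells and the rounds of loops, hence the total cost `P.comp Q * Q`.
  let Q : Polynomial ℕ := 2 * ((.X + 1) * (.X * .X)) + .X + 3
  refine ⟨Prog.decideZeroVariance, P.comp Q * Q, fun x => ?_⟩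
  set X := x.K + inputSize x.encode with hX
  have hQ : Q.eval X = 2 * ((X + 1) * (X * X)) + X + 3 := by simp [Q]
  have hlen : x.encode.length ≤ X :=
    (length_le_inputSize _).trans (Nat.le_add_left _ _)
  have hwidth : x.layout.width + x.layout.len + 2 ≤ Q.eval X := by
    have h1 : x.mdp.T ≤ X := x.horizon_le.trans hlen
    have h2 : x.rewardSum ≤ X * X := by
      refine x.rewardSum_le.trans (Nat.mul_le_mul ?_ (Nat.le_add_right _ _))
      exact x.layout.m_le.trans hlen
    have h3 : (x.mdp.T + 1) * x.rewardSum ≤ (X + 1) * (X * X) :=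
      Nat.mul_le_mul (Nat.succ_le_succ h1) h2
    rw [hQ]
    change 2 * ((x.mdp.T + 1) * x.rewardSum) + 1 + x.encode.length + 2 ≤ _
    omega
  have hbounded : (RAMState.ofInput x.encode).Bounded (Q.eval X) := by
    rw [hQ]
    refine ⟨fun i => ?_, fun i => (logCost_getD_le _ _).trans (by omega)⟩
    have h : (RAMState.ofInput x.encode).reg i ≤ x.encode.length := by
      simp only [RAMState.ofInput, Function.update_apply]
      split_ifs <;> simp
    exact (logCost_le_succ _).trans (by omega)
  have hrun := x.layout.reaches_decideZeroVariance hwidth (μ := fun i => x.encode.getD i 0)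
    (fun _ _ => rfl) fun i hi => by
      have : x.encode.length ≤ i := hi
      simp [List.getD, this]
  rw [x.ofInput_encode] at hbounded ⊢
  obtain ⟨n, st, h1, h2, -, h3, h4⟩ := hrun hbounded
  refine ⟨n, st, h1, ?_, ?_⟩
  · rwa [Polynomial.eval_mul, Polynomial.eval_comp, ← hP]
  · have h5 : st.reg 0 ≠ 0 ↔ ∃ π : x.mdp.Policy, x.mdp.V π = 0 :=
      h4.trans x.exists_ensuresShifted_iff.symm
    split_ifs with h
    · have := h5.2 h
      omega
    · by_contra h6
      exact h (h5.1 h6)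

end IntegerMDP

end MeanVariance

theorem theorem8 :
    (∀ (S : Type*) [Fintype S] (A : S → Type*) (M : MeanVariance.MDP S A),
      (∃ π : M.Policy, M.V π = 0) → ∃ π' ∈ M.PiTSW, M.V π' = 0) ∧
    MeanVariance.PseudopolynomialTime MeanVariance.IntegerMDP.encode MeanVariance.IntegerMDP.K
      (fun x => ∃ π : x.mdp.Policy, x.mdp.V π = 0) := by
  refine ⟨fun S _ A M ⟨π, hπ⟩ => ?_, MeanVariance.IntegerMDP.pseudopolynomialTime⟩
  obtain ⟨c, hc⟩ := MeanVariance.MDP.exists_ensures π hπ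
  exact MeanVariance.MDP.exists_mem_piTSW hc
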